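/- \textbf{Generalized networks.} A generalized network $(V,E,E^\infty)$ is a finite directed multigraph $(V,E)$ with a source $s$, a sink $t$, arc capacities $\nu_e>0$, transit times $\tau_e\ge 0$, and a set $E^\infty\subseteq E$ of free arcs. It contains an auxiliary arc $ts\in E^\infty$ from $t$ to $s$ with $\tau_{ts}=0$, whose capacity $\nu_{ts}=u_0>0$ is the network inflow rate. Every node is reachable from $s$, and $t$ is reachable from the head of every free arc. \textbf{Thin flows.} For $R\subseteq A\subseteq E$, a thin flow with configuration $(A,R)$ is a pair $(y,\lambda)$ with $\lambda\in\mathbb R^V$ and $y\in\mathbb R_{\ge0}^E$ a circulation that vanishes outside $A$, such that $\lambda_s=1$; $\lambda_w=\min_{e=vw\in A}\rho_e(\lambda_v,y_e)$ for all $w\in V$; and $\lambda_w=\rho_e(\lambda_v,y_e)$ for all $e=vw\in A$ with $y_e>0$. Here $\rho_e(\lambda_v,y_e)=y_e/\nu_e$ if $e\in R$, and $\rho_e(\lambda_v,y_e)=\max\{\lambda_v,y_e/\nu_e\}$ otherwise. \textbf{Nash flows over time.} For labels $\ell(\theta)\in\mathbb R^V$ let the active arcs $E'_\theta$ be $E^\infty$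 together with all $e=vw$ with $\ell_w(\theta)\ge\ell_v(\theta)+\tau_e$, and let the resetting arcs $E^*_\theta$ be $E^\infty$ together with all $e=vw$ with $\ell_w(\theta)>\ell_v(\theta)+\tau_e$. A Nash flow over time is a pair $(x,\ell)$ of families of locally absolutely continuous functions $x_e,\ell_v:[0,\infty)\to\mathbb R$ ($e\in E$, $v\in V$) such that for every $\theta\ge0$ every node is reachable from $s$ by arcs of $E'_\theta$, and for almost every $\theta\ge 0$ the pair $(x'(\theta),\ell'(\theta))$ is a thin flow with configuration $(E'_\theta,E^*_\theta)$. The queue (waiting time) of $e=vw$ is $q_e(\theta)=\ell_w(\theta)-\ell_v(\theta)-\tau_e$ if $e\in E^\infty$, and $q_e(\theta)=\max\{0,\ell_w(\theta)-\ell_v(\theta)-\tau_e\}$ otherwise. The Nash flow is in steady state at time $\theta_0$ if every $q_e$ is differentiable on $[\theta_0,\infty)$ (one-sidedly at the left end point) with constant derivative. \textbf{Theorem.} For every generalized network $(V,E,E^\infty)$ there is a thin flow $(y',\lambda')$ with configuration $(E,E^\infty)$ such that every Nash flow over time $(x,\ell)$ reaches a steady state in finite time, with queue rates determined by $\lambda'$: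 there is $\theta_0\ge0$ such that $(x,\ell)$ is in steady state at time $\theta_0$ and, for all $\theta\ge\theta_0$ and all $e=vw\in E$, \[ q'_e(\theta)=\begin{cases}\lambda'_w-\lambda'_v & \text{for } e\in E^\infty,\\ \max\{0,\lambda'_w-\lambda'_v\} & \text{for } e\in E\setminus E^\infty.\end{cases} \] -/

import Mathlib

open MeasureTheory

/-- A generalized network `(V, E, E^∞)` with source `s`, sink `t`, capacities `ν`, transit times `τ`
and set of free arcs `E^∞` (free arcs behave at all times as if they had a queue). Parallel arcs
are allowed. The constant inflow is modelled by the auxiliary free arc `ts` from the sink to the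
source, whose transit time is `0` and whose capacity is the network inflow rate `u₀`, so that
static flows are circulations. -/
structure GeneralizedNetwork (V E : Type*) where
  /-- tail of an arc -/
  src : E → V
  /-- head of an arc -/
  tgt : E → V
  /-- source -/
  s : V
  /-- sink -/
  t : V
  /-- capacities -/
  ν : E → ℝ
  /-- transit times -/
  τ : E → ℝ
  /-- the set `E^∞` of free arcs -/
  free : Set E
  /-- the auxiliary arc from the sink to the source -/
  ts : E
  ν_pos : ∀ e, 0 < ν e
  τ_nonneg : ∀ e, 0 ≤ τ e
  src_ts : src ts = t
  tgt_ts : tgt ts = s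
  τ_ts : τ ts = 0
  ts_mem_free : ts ∈ free
  /-- every node can be reached from the source -/
  reachable_from_source :
    ∀ v, Relation.ReflTransGen (fun a b => ∃ e, src e = a ∧ tgt e = b) s v
  /-- the sink can be reached from the head of every free arc -/
  free_reaches_sink :
    ∀ e ∈ free, Relation.ReflTransGen (fun a b => ∃ e', src e' = a ∧ tgt e' = b) (tgt e) t

namespace GeneralizedNetwork

variable {V E : Type*}

/-- There is a directed path (possibly of length zero) from `v` to `w` using arcs of `A` only. -/
def Reaches (G : GeneralizedNetwork V E) (A : Set E) (v w : V) : Prop :=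
  Relation.ReflTransGen (fun a b => ∃ e ∈ A, G.src e = a ∧ G.tgt e = b) v w

open Classical in
/-- Flow conservation at every node. -/
def IsCirculation [Fintype E] (G : GeneralizedNetwork V E) (y : E → ℝ) : Prop :=
  ∀ v, ∑ e with G.src e = v, y e = ∑ e with G.tgt e = v, y e

open Classical in
/-- `ρ_e(lam_v, y_e)` for `e = vw` and the set `R` of resetting arcs: `y_e / ν_e` if `e` is
resetting, and `max {lam_v, y_e / ν_e}` otherwise. -/
noncomputable def rho (G : GeneralizedNetwork V E) (R : Set E) (y : E → ℝ) (lam : V → ℝ)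
    (e : E) : ℝ :=
  if e ∈ R then y e / G.ν e else max (lam (G.src e)) (y e / G.ν e)

/-- `(y, lam)` is a thin flow with configuration `(A, R)`, where `A` is the set of active arcs
and `R` the set of resetting arcs. -/
structure IsThinFlow [Fintype E] (G : GeneralizedNetwork V E) (A R : Set E)
    (y : E → ℝ) (lam : V → ℝ) : Prop where
  nonneg : ∀ e, 0 ≤ y e
  support : ∀ e, e ∉ A → y e = 0
  circulation : G.IsCirculation y
  label_source : lam G.s = 1
  /-- `lam_w` is the minimum of `ρ_e(lam_v, y_e)` over the active arcs `e = vw` into `w` -/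
  label_min : ∀ w, IsLeast {r | ∃ e ∈ A, G.tgt e = w ∧ r = G.rho R y lam e} (lam w)
  /-- flow-carrying arcs attain the minimum -/
  label_flow : ∀ e ∈ A, 0 < y e → lam (G.tgt e) = G.rho R y lam e

/-- The active arcs `E'` for the labelling `l`: free arcs are always active. -/
def active (G : GeneralizedNetwork V E) (l : V → ℝ) : Set E :=
  {e | e ∈ G.free ∨ l (G.src e) + G.τ e ≤ l (G.tgt e)}

/-- The resetting arcs `E*` for the labelling `l`: free arcs are always resetting. -/
def resetting (G : GeneralizedNetwork V E) (l : V → ℝ) : Set E :=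
  {e | e ∈ G.free ∨ l (G.src e) + G.τ e < l (G.tgt e)}

/-- A Nash flow over time `(x, ℓ)` (on the time horizon `[0, ∞)`): the functions `x_e` and `ℓ_v`
are locally absolutely continuous, at all times every node is reached from the source by active
arcs, and for almost every time `θ` the derivatives `(x'(θ), ℓ'(θ))` are a thin flow with
configuration `(E'_θ, E*_θ)`. -/
structure IsNashFlow [Fintype E] (G : GeneralizedNetwork V E) (x : E → ℝ → ℝ) (ℓ : V → ℝ → ℝ) :
    Prop where
  flow_ac : ∀ e, ∀ T, 0 < T → AbsolutelyContinuousOnInterval (x e) 0 T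
  label_ac : ∀ v, ∀ T, 0 < T → AbsolutelyContinuousOnInterval (ℓ v) 0 T
  reaches : ∀ θ, 0 ≤ θ → ∀ v, G.Reaches (G.active fun u => ℓ u θ) G.s v
  thin : ∀ᵐ θ : ℝ, 0 ≤ θ → G.IsThinFlow (G.active fun u => ℓ u θ) (G.resetting fun u => ℓ u θ)
    (fun e => deriv (x e) θ) (fun v => deriv (ℓ v) θ)

open Classical in
/-- The queue (waiting time) `q_e(θ)` experienced on `e = vw` by the particle entering the network
at time `θ`; on free arcs it may be negative. -/
noncomputable def queue (G : GeneralizedNetwork V E) (ℓ : V → ℝ → ℝ) (e : E) (θ : ℝ) : ℝ :=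
  if e ∈ G.free then ℓ (G.tgt e) θ - ℓ (G.src e) θ - G.τ e
  else max 0 (ℓ (G.tgt e) θ - ℓ (G.src e) θ - G.τ e)

/-- The labels `ℓ` are in steady state at time `θ₀`: on `[θ₀, ∞)` all queues are differentiable
(from the right at `θ₀`) with constant derivative. -/
def InSteadyState (G : GeneralizedNetwork V E) (ℓ : V → ℝ → ℝ) (θ₀ : ℝ) : Prop :=
  ∃ c : E → ℝ, ∀ e, ∀ θ ≥ θ₀, HasDerivWithinAt (G.queue ℓ e) (c e) (Set.Ici θ₀) θ

open Classical in
/-- The queue rate `lam_w - lam_v` for free arcs `e = vw` and `max {0, lam_w - lam_v}` for the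
other arcs. -/
noncomputable def steadyRate (G : GeneralizedNetwork V E) (lam : V → ℝ) (e : E) : ℝ :=
  if e ∈ G.free then lam (G.tgt e) - lam (G.src e)
  else max 0 (lam (G.tgt e) - lam (G.src e))

end GeneralizedNetwork

open Filter Topology

/-! ### Paths, circulations and cuts -/

namespace GeneralizedNetwork

variable {V E : Type*} {G : GeneralizedNetwork V E}

/-! Wherever `ℓ_w = ℓ_v + τ_e`, the derivatives of both sides agree for almost every such time. So
almost everywhere the derivatives form a tight flow (`IsTight`): resetting arcs carry `ν_e λ_w`, and
the other active arcs have equal label rates at both ends. By a cut argument the configuration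
determines these rates, so only finitely many label rates occur.

The limiting rate is the label vector `q` of a cone flow: a tight flow for the very configuration
that `q` induces through the order of its entries. `exists_coneFlow` constructs it as a limit of
maximal subsolutions; it is positive and unique (`IsConeFlow.pos`, `IsConeFlow.label_unique`).

Convergence rests on one inequality, `IsTight.sum_le_neg_dissipation`, which follows from `log u ≤ u
- 1` because a circulation annihilates differences of logarithms of labels. It is used twice, with
different target ratios `k_e`.

With the current label ratios as `k_e`, it shows that a relative entropy of the labels decreases at
least at the rate of the dissipation. The entropy is bounded below, whereas a deviation of `ℓ(θ)/θ`
from `q` persists for a time proportional to `θ` and costs a fixed rate of dissipation meanwhile.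
Hence `ℓ(θ)/θ → q` (`tendsto_label_div`), and the configuration eventually respects the strict
inequalities between the entries of `q`.

With `k_e = q_w / q_v`, it shows that a piecewise linear potential decreases, and at a uniform rate
while `ℓ' ≠ q`, since only finitely many rates are possible. Weak duality bounds the potential
below, so `ℓ' = q` at some time. Complementary slackness shows that the potential is then minimal;
it stays constant, which forces `ℓ' = q` almost everywhere afterwards (`exists_label_linear`).
Linear queues follow. -/

theorem Reaches.mono {A B : Set E} (h : A ⊆ B) {v w : V} (hr : G.Reaches A v w) :
    G.Reaches B v w :=
  Relation.ReflTransGen.mono (fun _ _ ⟨e, he, h1, h2⟩ => ⟨e, h he, h1, h2⟩) _ _ hr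

theorem exists_entering_arc {r : V → V → Prop} {v w : V} (h : Relation.ReflTransGen r v w)
    {T : Set V} (hv : v ∉ T) (hw : w ∈ T) : ∃ a b, r a b ∧ a ∉ T ∧ b ∈ T := by
  induction h with
  | refl => exact absurd hw hv
  | @tail b c _ hbc ih =>
    by_cases hb : b ∈ T
    · exact ih hb
    · exact ⟨b, c, hbc, hb, hw⟩

/-- A directed path entering `T` uses an arc entering `T`. -/
theorem Reaches.exists_entering {A : Set E} {v w : V} (h : G.Reaches A v w)
    {T : Set V} (hv : v ∉ T) (hw : w ∈ T) : ∃ e ∈ A, G.src e ∉ T ∧ G.tgt e ∈ T := by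
  obtain ⟨a, b, ⟨e, he, rfl, rfl⟩, ha, hb⟩ := exists_entering_arc h hv hw
  exact ⟨e, he, ha, hb⟩

theorem Reaches.last_arc {A : Set E} {v w : V} (h : G.Reaches A v w) (hne : v ≠ w) :
    ∃ e ∈ A, G.tgt e = w := by
  rcases Relation.ReflTransGen.cases_tail h with h | ⟨c, _, e, he, _, h2⟩
  · exact absurd h.symm hne
  · exact ⟨e, he, h2⟩

section Finite

variable [Fintype E]

open Classical in
/-- Inflow minus outflow of a node. -/
noncomputable def excess (G : GeneralizedNetwork V E) (y : E → ℝ) (v : V) : ℝ :=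
  ∑ e with G.tgt e = v, y e - ∑ e with G.src e = v, y e

theorem isCirculation_iff_excess {y : E → ℝ} : G.IsCirculation y ↔ ∀ v, G.excess y v = 0 :=
  forall_congr' fun v => by rw [excess, sub_eq_zero, eq_comm]

theorem sum_mul_sub_eq_excess [Fintype V] (y : E → ℝ) (g : V → ℝ) :
    ∑ e, y e * (g (G.tgt e) - g (G.src e)) = ∑ v, g v * G.excess y v := by
  classical
  have key : ∀ f : E → V, ∑ e, y e * g (f e) = ∑ v, g v * ∑ e with f e = v, y e := by
    intro f
    rw [← Finset.sum_fiberwise (s := Finset.univ) (g := f)]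
    refine Finset.sum_congr rfl fun v _ => ?_
    rw [Finset.mul_sum]
    refine Finset.sum_congr rfl fun e he => ?_
    rw [(Finset.mem_filter.1 he).2, mul_comm]
  simp only [mul_sub, Finset.sum_sub_distrib, excess]
  rw [key, key]

/-- Circulations are orthogonal to potential differences. The potentials used are indicators of node
sets, logarithms of labels, and quotients `l / q`. -/
theorem IsCirculation.sum_mul_sub [Fintype V] {y : E → ℝ} (h : G.IsCirculation y) (g : V → ℝ) :
    ∑ e, y e * (g (G.tgt e) - g (G.src e)) = 0 := by
  rw [sum_mul_sub_eq_excess]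
  exact Finset.sum_eq_zero fun v _ => by rw [isCirculation_iff_excess.1 h v, mul_zero]

/-- If the net flow over every arc crossing a cut is directed inwards, then it vanishes. -/
theorem IsCirculation.cut [Fintype V] {y : E → ℝ} (h : G.IsCirculation y) (T : Set V)
    (hin : ∀ e, G.src e ∉ T → G.tgt e ∈ T → 0 ≤ y e)
    (hout : ∀ e, G.src e ∈ T → G.tgt e ∉ T → y e ≤ 0) :
    (∀ e, G.src e ∉ T → G.tgt e ∈ T → y e = 0) ∧
      (∀ e, G.src e ∈ T → G.tgt e ∉ T → y e = 0) := by
  classical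
  have hs := h.sum_mul_sub (fun v => if v ∈ T then (1 : ℝ) else 0)
  have hn : ∀ e ∈ Finset.univ, 0 ≤ y e * ((if G.tgt e ∈ T then (1 : ℝ) else 0) -
      if G.src e ∈ T then (1 : ℝ) else 0) := by
    intro e _
    by_cases h1 : G.src e ∈ T <;> by_cases h2 : G.tgt e ∈ T <;> simp only [h1, h2, if_true, if_false]
    · simp
    · have := hout e h1 h2; linarith
    · have := hin e h1 h2; linarith
    · simp
  have hz := (Finset.sum_eq_zero_iff_of_nonneg hn).1 hs
  refine ⟨fun e h1 h2 => ?_, fun e h1 h2 => ?_⟩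
  · simpa [h1, h2] using hz e (Finset.mem_univ e)
  · simpa [h1, h2] using hz e (Finset.mem_univ e)

theorem IsCirculation.sub_mul {y z : E → ℝ} (hy : G.IsCirculation y) (hz : G.IsCirculation z)
    (r : ℝ) : G.IsCirculation (fun e => y e - r * z e) := by
  intro v
  simp only [Finset.sum_sub_distrib, ← Finset.mul_sum]
  rw [hy v, hz v]

/-! ### Tight flows: uniqueness and finiteness of labels -/

/-- Thin flows whose active non-resetting arcs have equal labels at both ends, in an explicit
form: resetting arcs carry flow `ν_e lam_w`. -/
structure IsTight (G : GeneralizedNetwork V E) (A R : Set E) (y : E → ℝ) (lam : V → ℝ) :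
    Prop where
  free_subset : G.free ⊆ R
  subset : R ⊆ A
  reaches : ∀ v, G.Reaches A G.s v
  circulation : G.IsCirculation y
  flow_nonneg : ∀ e, 0 ≤ y e
  label_nonneg : ∀ v, 0 ≤ lam v
  label_source : lam G.s = 1
  flow_eq_zero : ∀ e, e ∉ A → y e = 0
  flow_eq : ∀ e ∈ R, y e = G.ν e * lam (G.tgt e)
  flow_le : ∀ e, y e ≤ G.ν e * lam (G.tgt e)
  label_eq : ∀ e ∈ A, e ∉ R → lam (G.tgt e) = lam (G.src e)

/-- Cut argument for the set where `lam'` is smaller. Only resetting arcs can carry flow across it,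
since labels agree along the other active arcs. Entering arcs carry strictly more in `y`, leaving
arcs at most as much, so conservation of `y - y'` forbids any active entering arc, against
reachability. -/
theorem IsTight.label_le [Fintype V] {A R : Set E} {y y' : E → ℝ} {lam lam' : V → ℝ}
    (h : G.IsTight A R y lam) (h' : G.IsTight A R y' lam') (v : V) : lam v ≤ lam' v := by
  by_contra! hv
  have hin : ∀ e, G.src e ∉ {v | lam' v < lam v} → G.tgt e ∈ {v | lam' v < lam v} →
      0 ≤ y e - 1 * y' e := by
    intro e h1 h2
    simp only [Set.mem_ofPred_eq, not_lt] at h1 h2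
    by_cases hA : e ∈ A
    · by_cases hR : e ∈ R
      · rw [h.flow_eq e hR, h'.flow_eq e hR]
        have := mul_lt_mul_of_pos_left h2 (G.ν_pos e)
        linarith
      · have := h.label_eq e hA hR
        have := h'.label_eq e hA hR
        linarith
    · simp [h.flow_eq_zero e hA, h'.flow_eq_zero e hA]
  have hout : ∀ e, G.src e ∈ {v | lam' v < lam v} → G.tgt e ∉ {v | lam' v < lam v} →
      y e - 1 * y' e ≤ 0 := by
    intro e h1 h2
    simp only [Set.mem_ofPred_eq, not_lt] at h1 h2
    by_cases hA : e ∈ A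
    · by_cases hR : e ∈ R
      · rw [h.flow_eq e hR, h'.flow_eq e hR]
        have := mul_le_mul_of_nonneg_left h2 (G.ν_pos e).le
        linarith
      · have := h.label_eq e hA hR
        have := h'.label_eq e hA hR
        linarith
    · simp [h.flow_eq_zero e hA, h'.flow_eq_zero e hA]
  obtain ⟨hc, -⟩ := (h.circulation.sub_mul h'.circulation 1).cut _ hin hout
  obtain ⟨e, he, h1, h2⟩ := (h.reaches v).exists_entering (T := {v | lam' v < lam v})
    (by simp [h.label_source, h'.label_source]) hv
  have h3 := hc e h1 h2
  simp only [Set.mem_ofPred_eq, not_lt] at h1 h2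
  by_cases hR : e ∈ R
  · rw [h.flow_eq e hR, h'.flow_eq e hR] at h3
    have := mul_lt_mul_of_pos_left h2 (G.ν_pos e)
    linarith
  · have := h.label_eq e he hR
    have := h'.label_eq e he hR
    linarith

theorem IsTight.label_unique [Fintype V] {A R : Set E} {y y' : E → ℝ} {lam lam' : V → ℝ}
    (h : G.IsTight A R y lam) (h' : G.IsTight A R y' lam') : lam = lam' :=
  funext fun v => le_antisymm (h.label_le h' v) (h'.label_le h v)

variable (G) in
-- There are finitely many configurations and each has at most one label vector. Both the bound on
-- the rates and the dissipation gap come from this.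
theorem finite_tight_labels [Fintype V] : {lam : V → ℝ | ∃ A R y, G.IsTight A R y lam}.Finite := by
  have : {lam : V → ℝ | ∃ A R y, G.IsTight A R y lam} =
      ⋃ c : Set E × Set E, {lam : V → ℝ | ∃ y, G.IsTight c.1 c.2 y lam} := by
    ext lam; simp
  rw [this]
  exact Set.finite_iUnion fun c => Set.Subsingleton.finite fun a ⟨y, ha⟩ b ⟨z, hb⟩ =>
    ha.label_unique hb

/-- A node of label zero has no inflow by the capacity bound, hence no outflow. -/
theorem IsCirculation.flow_eq_zero_of_label {y : E → ℝ} {lam : V → ℝ} (hc : G.IsCirculation y)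
    (h0 : ∀ e, 0 ≤ y e) (hle : ∀ e, y e ≤ G.ν e * lam (G.tgt e)) {e : E}
    (he : lam (G.src e) = 0) : y e = 0 := by
  classical
  refine le_antisymm ?_ (h0 e)
  have h1 : y e ≤ ∑ e' with G.src e' = G.src e, y e' :=
    Finset.single_le_sum (f := y) (fun i _ => h0 i) (by simp)
  have h2 : ∑ e' with G.tgt e' = G.src e, y e' ≤ 0 := by
    refine Finset.sum_nonpos fun i hi => ?_
    have := hle i
    rwa [(Finset.mem_filter.1 hi).2, he, mul_zero] at this
  have h3 := hc (G.src e)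
  have h4 : ∑ e' with G.src e' = G.src e, y e' = ∑ e' with G.tgt e' = G.src e, y e' := by
    convert h3
  linarith

/-! ### Cone flows: positivity, uniqueness, thin flow property -/

/-- The arcs that are active for the asymptotic directions `p`. -/
def coneActive (G : GeneralizedNetwork V E) (p : V → ℝ) : Set E :=
  {e | e ∈ G.free ∨ p (G.src e) ≤ p (G.tgt e)}

/-- The arcs that are resetting for the asymptotic directions `p`. -/
def coneResetting (G : GeneralizedNetwork V E) (p : V → ℝ) : Set E :=
  {e | e ∈ G.free ∨ p (G.src e) < p (G.tgt e)}

/-- No arc leads from label zero to a positive label: it would carry flow out of a node that has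
none. A path from `s` can therefore enter the zero set only by a free arc. From its head the sink is
reachable, so the sink has label zero, and `ts` passes this on to `s`. The statement fits both cone
flows and limits of rescaled cumulative flows. -/
theorem label_pos {X : E → ℝ} {p : V → ℝ} (hc : G.IsCirculation X) (h0 : ∀ e, 0 ≤ X e)
    (hp : ∀ v, 0 ≤ p v) (hle : ∀ e, X e ≤ G.ν e * p (G.tgt e))
    (hpos : ∀ e, p (G.src e) = 0 → 0 < p (G.tgt e) → 0 < X e)
    (hs : 0 < p G.s) (hr : ∀ v, G.Reaches (G.coneActive p) G.s v) (v : V) : 0 < p v := by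
  by_contra! hv
  have hv0 : p v = 0 := le_antisymm hv (hp v)
  have hsZ : G.s ∉ {v | p v = 0} := hs.ne'
  have hleave : ∀ e, p (G.src e) = 0 → p (G.tgt e) = 0 := by
    intro e h1
    by_contra h2
    exact (hpos e h1 (lt_of_le_of_ne (hp _) (Ne.symm h2))).ne'
      (hc.flow_eq_zero_of_label h0 hle h1)
  obtain ⟨e, he, h1, h2⟩ := (hr v).exists_entering hsZ (show v ∈ {v | p v = 0} from hv0)
  simp only [Set.mem_ofPred_eq] at h1 h2
  rcases he with he | he
  · by_cases ht : p G.t = 0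
    · have := hleave G.ts (by rw [G.src_ts]; exact ht)
      rw [G.tgt_ts] at this
      exact hs.ne' this
    · obtain ⟨a, b, ⟨e', rfl, rfl⟩, h3, h4⟩ := exists_entering_arc (G.free_reaches_sink e he)
        (T := {v | p v ≠ 0}) (by simpa using h2) ht
      simp only [Set.mem_ofPred_eq, not_not] at h3 h4
      exact h4 (hleave e' h3)
  · rw [h2] at he
    exact h1 (le_antisymm he (hp _))

/-- `(y, p)` is a thin flow that reproduces the directions `p`. -/
def IsConeFlow (G : GeneralizedNetwork V E) (y : E → ℝ) (p : V → ℝ) : Prop :=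
  G.IsTight (G.coneActive p) (G.coneResetting p) y p

theorem IsConeFlow.pos {y : E → ℝ} {p : V → ℝ} (h : G.IsConeFlow y p) (v : V) : 0 < p v :=
  label_pos h.circulation h.flow_nonneg h.label_nonneg h.flow_le
    (fun e h1 h2 => by
      rw [h.flow_eq e (Or.inr (by rwa [h1]))]
      exact mul_pos (G.ν_pos e) h2)
    (by rw [h.label_source]; exact one_pos) h.reaches v

/-- Configurations depend only on the order of labels, so ratios are compared. Let `r > 1` be the
maximum of `p / q`, attained on `T`. An entering arc active for `q` is resetting for `p`, and a
leaving arc active for `p` is resetting for `q`; hence `y - r z` has the signs of the cut lemma.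
Equality empties the leaving arcs of `y`-flow, and a second cut, for `y` alone, empties the entering
ones, against reachability and positivity. -/
theorem IsConeFlow.label_le [Fintype V] {y z : E → ℝ} {p q : V → ℝ} (h : G.IsConeFlow y p)
    (h' : G.IsConeFlow z q) (v : V) : p v ≤ q v := by
  have hne : Nonempty V := ⟨G.s⟩
  obtain ⟨m, hm⟩ := Finite.exists_max (fun v => p v / q v)
  set r := p m / q m with hr
  have hle : ∀ v, p v ≤ r * q v := fun v => (div_le_iff₀ (h'.pos v)).1 (hm v)
  suffices hr1 : r ≤ 1 by
    have := hle v
    nlinarith [h'.pos v]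
  by_contra! hr1
  have hmT : m ∈ {v | p v = r * q v} := by
    simp [hr, div_mul_cancel₀ _ (h'.pos m).ne']
  have hsT : G.s ∉ {v | p v = r * q v} := by
    simp only [Set.mem_ofPred_eq, h.label_source, h'.label_source]
    linarith
  have hr0 : 0 < r := by linarith
  have hin : ∀ e, G.src e ∉ {v | p v = r * q v} → G.tgt e ∈ {v | p v = r * q v} →
      0 ≤ y e - r * z e := by
    intro e h1 h2
    simp only [Set.mem_ofPred_eq] at h1 h2
    have h1' := lt_of_le_of_ne (hle _) h1
    by_cases hA : e ∈ G.coneActive q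
    · have hR : e ∈ G.coneResetting p := by
        rcases hA with hA | hA
        · exact Or.inl hA
        · refine Or.inr (h1'.trans_le ?_)
          rw [h2]
          exact mul_le_mul_of_nonneg_left hA hr0.le
      have h3 := h'.flow_le e
      rw [h.flow_eq e hR, h2]
      nlinarith
    · rw [h'.flow_eq_zero e hA]
      simpa using h.flow_nonneg e
  have hout : ∀ e, G.src e ∈ {v | p v = r * q v} → G.tgt e ∉ {v | p v = r * q v} →
      y e - r * z e ≤ 0 ∧ (y e - r * z e = 0 → y e = 0) := by
    intro e h1 h2
    simp only [Set.mem_ofPred_eq] at h1 h2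
    have h2' := lt_of_le_of_ne (hle _) h2
    by_cases hA : e ∈ G.coneActive p
    · have hR : e ∈ G.coneResetting q := by
        rcases hA with hA | hA
        · exact Or.inl hA
        · refine Or.inr (lt_of_mul_lt_mul_left ?_ hr0.le)
          rw [← h1]
          exact hA.trans_lt h2'
      have h3 := h.flow_le e
      rw [h'.flow_eq e hR]
      have h4 := mul_lt_mul_of_pos_left h2' (G.ν_pos e)
      have h5 : y e - r * (G.ν e * q (G.tgt e)) < 0 := by nlinarith
      exact ⟨h5.le, fun h6 => absurd h6 h5.ne⟩
    · rw [h.flow_eq_zero e hA]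
      have := mul_nonneg hr0.le (h'.flow_nonneg e)
      exact ⟨by linarith, fun _ => rfl⟩
  have hc1 := ((h.circulation.sub_mul h'.circulation r).cut _ hin fun e h1 h2 => (hout e h1 h2).1).2
  have hc2 := (h.circulation.cut {v | p v = r * q v} (fun e _ _ => h.flow_nonneg e)
    fun e h1 h2 => ((hout e h1 h2).2 (hc1 e h1 h2)).le).1
  obtain ⟨e, he, h1, h2⟩ := (h'.reaches m).exists_entering hsT hmT
  have h3 := hc2 e h1 h2
  simp only [Set.mem_ofPred_eq] at h1 h2
  have hR : e ∈ G.coneResetting p := by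
    rcases he with hA | hA
    · exact Or.inl hA
    · refine Or.inr ((lt_of_le_of_ne (hle _) h1).trans_le ?_)
      rw [h2]
      exact mul_le_mul_of_nonneg_left hA hr0.le
  rw [h.flow_eq e hR] at h3
  exact (mul_pos (G.ν_pos e) (h.pos _)).ne' h3

theorem IsConeFlow.label_unique [Fintype V] {y z : E → ℝ} {p q : V → ℝ} (h : G.IsConeFlow y p)
    (h' : G.IsConeFlow z q) : p = q :=
  funext fun v => le_antisymm (h.label_le h' v) (h'.label_le h v)

/-- Declaring every arc active is harmless: if a non-free arc has `p_v > p_w`, its `ρ_e` is at least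
`p_v` and does not affect the minimum at `w`. If `p_v < p_w`, the arc carries `ν_e p_w`, so the
maximum in `ρ_e` is `p_w`. -/
theorem IsConeFlow.isThinFlow {y : E → ℝ} {p : V → ℝ} (h : G.IsConeFlow y p) :
    G.IsThinFlow Set.univ G.free y p := by
  have hrho : ∀ e, p (G.tgt e) ≤ G.rho G.free y p e ∧
      (e ∈ G.coneActive p → p (G.tgt e) = G.rho G.free y p e) := by
    intro e
    have hdiv : e ∈ G.coneResetting p → y e / G.ν e = p (G.tgt e) := fun hR => by
      rw [h.flow_eq e hR, mul_div_cancel_left₀ _ (G.ν_pos e).ne']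
    have hle : y e / G.ν e ≤ p (G.tgt e) := by
      rw [div_le_iff₀ (G.ν_pos e), mul_comm]; exact h.flow_le e
    unfold rho
    split_ifs with hf
    · rw [hdiv (Or.inl hf)]
      simp
    · rcases lt_trichotomy (p (G.src e)) (p (G.tgt e)) with hlt | heq | hgt
      · rw [hdiv (Or.inr hlt), max_eq_right hlt.le]
        simp
      · rw [heq, max_eq_left hle]
        simp
      · refine ⟨hgt.le.trans (le_max_left _ _), fun hA => ?_⟩
        rcases hA with hA | hA
        · exact absurd hA hf
        · exact absurd hA (not_le.2 hgt)
  refine ⟨h.flow_nonneg, fun e he => absurd (Set.mem_univ e) he, h.circulation, h.label_source,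
    fun w => ⟨?_, ?_⟩, fun e _ hy => ?_⟩
  · have : ∃ e ∈ G.coneActive p, G.tgt e = w := by
      by_cases hw : G.s = w
      · exact ⟨G.ts, Or.inl G.ts_mem_free, by rw [G.tgt_ts, hw]⟩
      · exact (h.reaches w).last_arc hw
    obtain ⟨e, he, rfl⟩ := this
    exact ⟨e, Set.mem_univ e, rfl, (hrho e).2 he⟩
  · rintro r ⟨e, -, rfl, rfl⟩
    exact (hrho e).1
  · refine (hrho e).2 ?_
    by_contra hA
    rw [h.flow_eq_zero e hA] at hy
    exact lt_irrefl _ hy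

end Finite

end GeneralizedNetwork

/-! ### Existence of cone flows by approximation -/

theorem exists_subseq_tendsto_of_abs_le {ι : Type*} [Finite ι] (u : ℕ → ι → ℝ) (B : ℝ)
    (h : ∀ n i, |u n i| ≤ B) :
    ∃ (φ : ℕ → ℕ) (a : ι → ℝ), StrictMono φ ∧
      ∀ i, Tendsto (fun n => u (φ n) i) atTop (𝓝 (a i)) := by
  obtain ⟨a, -, φ, hφ, ha⟩ := (isCompact_Icc (a := fun _ : ι => -B) (b := fun _ => B)).tendsto_subseq
    (x := u) fun n => ⟨fun i => (abs_le.1 (h n i)).1, fun i => (abs_le.1 (h n i)).2⟩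
  exact ⟨φ, a, hφ, fun i => (tendsto_pi_nhds.1 ha) i⟩

namespace GeneralizedNetwork

variable {V E : Type*} {G : GeneralizedNetwork V E}

open Classical in
/-- A continuous approximation of the flow determined by the labels: non-free arcs carry flow
`ν_e lam_w` as soon as `lam_w` exceeds `lam_v` sufficiently. -/
noncomputable def approxFlow (G : GeneralizedNetwork V E) (n : ℝ) (lam : V → ℝ) (e : E) : ℝ :=
  if e ∈ G.free then G.ν e * lam (G.tgt e)
  else G.ν e * min (lam (G.tgt e)) (n * max (lam (G.tgt e) - lam (G.src e)) 0)

theorem approxFlow_nonneg {n : ℝ} (hn : 0 ≤ n) {lam : V → ℝ} (h : ∀ v, 0 ≤ lam v) (e : E) :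
    0 ≤ G.approxFlow n lam e := by
  have := (G.ν_pos e).le
  have := h (G.tgt e)
  unfold approxFlow
  split_ifs <;> positivity

theorem approxFlow_le {n : ℝ} {lam : V → ℝ} (e : E) :
    G.approxFlow n lam e ≤ G.ν e * lam (G.tgt e) := by
  unfold approxFlow
  split_ifs
  · exact le_rfl
  · exact mul_le_mul_of_nonneg_left (min_le_left _ _) (G.ν_pos e).le

theorem approxFlow_free {n : ℝ} {lam : V → ℝ} {e : E} (he : e ∈ G.free) :
    G.approxFlow n lam e = G.ν e * lam (G.tgt e) := if_pos he

theorem approxFlow_eq_zero {n : ℝ} {lam : V → ℝ} (h : ∀ v, 0 ≤ lam v) {e : E} (he : e ∉ G.free)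
    (hlt : lam (G.tgt e) ≤ lam (G.src e)) : G.approxFlow n lam e = 0 := by
  rw [approxFlow, if_neg he, max_eq_right (sub_nonpos.2 hlt), mul_zero, min_eq_right (h _),
    mul_zero]

theorem le_approxFlow {n : ℝ} (hn : 1 ≤ n) {lam : V → ℝ} (h : ∀ v, 0 ≤ lam v) (e : E) :
    G.ν e * (lam (G.tgt e) - lam (G.src e)) ≤ G.approxFlow n lam e := by
  have h1 := h (G.src e)
  unfold approxFlow
  split_ifs
  · exact mul_le_mul_of_nonneg_left (by linarith) (G.ν_pos e).le
  · refine mul_le_mul_of_nonneg_left (le_min (by linarith) ?_) (G.ν_pos e).le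
    have h2 := le_max_left (lam (G.tgt e) - lam (G.src e)) 0
    have h3 := le_max_right (lam (G.tgt e) - lam (G.src e)) 0
    nlinarith

theorem continuous_approxFlow (n : ℝ) (e : E) :
    Continuous fun lam : V → ℝ => G.approxFlow n lam e := by
  unfold approxFlow
  split_ifs <;> fun_prop

section Finite

variable [Fintype E]

theorem continuous_excess (v : V) : Continuous fun y : E → ℝ => G.excess y v := by
  unfold excess
  fun_prop

theorem continuous_excess_approxFlow (n : ℝ) (v : V) :
    Continuous fun lam : V → ℝ => G.excess (G.approxFlow n lam) v :=
  (continuous_excess v).comp (continuous_pi fun e => continuous_approxFlow n e)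

open Classical in
/-- Raising the label of one node does not increase the excess of any other node. -/
theorem excess_approxFlow_update_le {n : ℝ} (hn : 0 ≤ n) (lam : V → ℝ) {u v : V} (huv : u ≠ v)
    {t : ℝ} (ht : lam v ≤ t) :
    G.excess (G.approxFlow n (Function.update lam v t)) u ≤ G.excess (G.approxFlow n lam) u := by
  have hle : ∀ w, lam w ≤ Function.update lam v t w := by
    intro w
    by_cases hw : w = v
    · subst hw; simpa using ht
    · simp [hw]
  unfold excess
  refine sub_le_sub (Finset.sum_le_sum fun e he => ?_) (Finset.sum_le_sum fun e he => ?_)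
  · have hu := (Finset.mem_filter.1 he).2
    have h1 : Function.update lam v t (G.tgt e) = lam (G.tgt e) := by
      rw [hu, Function.update_of_ne huv]
    have h2 := hle (G.src e)
    have h3 := (G.ν_pos e).le
    unfold approxFlow
    rw [h1]
    split_ifs
    · exact le_rfl
    · gcongr
  · have hu := (Finset.mem_filter.1 he).2
    have h1 : Function.update lam v t (G.src e) = lam (G.src e) := by
      rw [hu, Function.update_of_ne huv]
    have h2 := hle (G.tgt e)
    have h3 := (G.ν_pos e).le
    unfold approxFlow
    rw [h1]
    split_ifs
    · gcongr
    · gcongr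

variable [Fintype V]

/-- A subsolution with maximal label sum has excess exactly `1/n` at uncapped nodes other than `s`:
otherwise that label could be raised a little, which increases no excess elsewhere. The strictly
positive slack `1/n` later yields reachability. -/
theorem exists_maximal_subsolution {n : ℝ} (hn : 1 ≤ n) :
    ∃ lam : V → ℝ, (∀ v, 0 ≤ lam v) ∧ lam G.s = 1 ∧
      (∀ v, v ≠ G.s → G.excess (G.approxFlow n lam) v ≤ n⁻¹) ∧
      ∀ v, v ≠ G.s → lam v < n → G.excess (G.approxFlow n lam) v = n⁻¹ := by
  classical
  have hn0 : 0 < n := by linarith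
  set S : Set (V → ℝ) := Set.Icc 0 (fun _ => n) ∩ ({lam | lam G.s = 1} ∩
    ⋂ v, ⋂ (_ : v ≠ G.s), {lam | G.excess (G.approxFlow n lam) v ≤ n⁻¹}) with hS
  have hcl : IsClosed ({lam : V → ℝ | lam G.s = 1} ∩
      ⋂ v, ⋂ (_ : v ≠ G.s), {lam | G.excess (G.approxFlow n lam) v ≤ n⁻¹}) := by
    refine IsClosed.inter (isClosed_eq (by fun_prop) (by fun_prop)) ?_
    exact isClosed_iInter fun v => isClosed_iInter fun _ =>
      isClosed_le (continuous_excess_approxFlow n v) continuous_const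
  have hmem : ∀ lam, lam ∈ S ↔ (∀ v, 0 ≤ lam v) ∧ (∀ v, lam v ≤ n) ∧ lam G.s = 1 ∧
      ∀ v, v ≠ G.s → G.excess (G.approxFlow n lam) v ≤ n⁻¹ := by
    intro lam
    simp [hS, Pi.le_def, and_assoc]
  have hne : S.Nonempty := by
    -- The indicator of the source is feasible: no flow enters a node of label zero.
    refine ⟨fun v => if v = G.s then 1 else 0, (hmem _).2 ⟨fun v => ?_, fun v => ?_, by simp, ?_⟩⟩
    · split_ifs <;> norm_num
    · split_ifs <;> linarith
    · intro v hv
      refine le_trans ?_ (inv_nonneg.2 hn0.le)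
      have h1 : ∀ e, G.tgt e = v →
          G.approxFlow n (fun v => if v = G.s then 1 else 0) e ≤ 0 := by
        intro e he
        refine (approxFlow_le e).trans ?_
        simp [he, hv]
      have h2 : ∀ e, 0 ≤ G.approxFlow n (fun v => if v = G.s then 1 else 0) e :=
        approxFlow_nonneg hn0.le fun v => by split_ifs <;> norm_num
      unfold excess
      have h3 := Finset.sum_nonneg (s := Finset.univ.filter fun e => G.src e = v) fun e _ => h2 e
      have h4 := Finset.sum_nonpos (s := Finset.univ.filter fun e => G.tgt e = v)
        fun e he => h1 e (Finset.mem_filter.1 he).2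
      linarith
  obtain ⟨lam, hlam, hmax⟩ := (isCompact_Icc.inter_right hcl).exists_isMaxOn hne
    (f := fun lam : V → ℝ => ∑ v, lam v) (by fun_prop)
  obtain ⟨h0, h1, hs, hex⟩ := (hmem lam).1 hlam
  refine ⟨lam, h0, hs, hex, fun v hv hlt => le_antisymm (hex v hv) ?_⟩
  by_contra! hlt'
  have hcont : Continuous fun t : ℝ => G.excess (G.approxFlow n (Function.update lam v t)) v :=
    (continuous_excess_approxFlow n v).comp (continuous_const.update v continuous_id)
  have hev : ∀ᶠ t in 𝓝 (lam v), G.excess (G.approxFlow n (Function.update lam v t)) v < n⁻¹ ∧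
      t < n := by
    refine (hcont.continuousAt.eventually_lt continuousAt_const ?_).and (Iio_mem_nhds hlt)
    simpa using hlt'
  obtain ⟨t, ⟨ht1, ht2⟩, ht3⟩ :=
    ((hev.filter_mono nhdsWithin_le_nhds).and (self_mem_nhdsWithin (s := Set.Ioi (lam v)))).exists
  have ht3 : lam v < t := ht3
  have hnew : Function.update lam v t ∈ S := by
    refine (hmem _).2 ⟨fun w => ?_, fun w => ?_, ?_, fun w hw => ?_⟩
    · by_cases hw : w = v
      · subst hw; simpa using (h0 w).trans ht3.le
      · simpa [hw] using h0 w
    · by_cases hw : w = v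
      · subst hw; simpa using ht2.le
      · simpa [hw] using h1 w
    · rw [Function.update_of_ne hv.symm, hs]
    · by_cases hwv : w = v
      · subst hwv; exact ht1.le
      · exact (excess_approxFlow_update_le hn0.le lam hwv ht3.le).trans (hex w hw)
  have h2 : ∑ w, Function.update lam v t w ≤ ∑ w, lam w := hmax hnew
  have h3 : ∑ w, lam w < ∑ w, Function.update lam v t w := by
    refine Finset.sum_lt_sum (fun w _ => ?_) ⟨v, Finset.mem_univ v, by simpa using ht3⟩
    by_cases hw : w = v
    · subst hw; simpa using ht3.le
    · simp [hw]
  linarith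

/-- If no label lay in `(B, K B]`, an arc entering the set of labels above `B` would carry at least
`ν_e (K - 1) B`. The arcs leaving this set carry at most `B ∑ ν`, and its total excess is at most
the number of nodes, which is too little. -/
theorem exists_label_le_mul {n K B : ℝ} (hn : 1 ≤ n) (hB : 1 ≤ B)
    (hK : ∀ e, (∑ e, G.ν e) + Fintype.card V ≤ G.ν e * (K - 1)) {lam : V → ℝ}
    (h0 : ∀ v, 0 ≤ lam v) (hs : lam G.s = 1)
    (hex : ∀ v, v ≠ G.s → G.excess (G.approxFlow n lam) v ≤ 1) {v : V} (hv : B < lam v) :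
    ∃ w, B < lam w ∧ lam w ≤ K * B := by
  classical
  by_contra! hcon
  obtain ⟨a, b, ⟨e, rfl, rfl⟩, hsrc, htgt⟩ := exists_entering_arc (G.reachable_from_source v)
    (T := {v | B < lam v}) (by simp [hs, hB]) hv
  simp only [Set.mem_ofPred_eq, not_lt] at hsrc htgt
  have hsum := sum_mul_sub_eq_excess (G := G) (G.approxFlow n lam)
    (fun v => if B < lam v then 1 else 0)
  have h1 : ∑ v, (if B < lam v then (1 : ℝ) else 0) * G.excess (G.approxFlow n lam) v ≤
      Fintype.card V := by
    have : ∑ v : V, (1 : ℝ) = Fintype.card V := by simp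
    rw [← this]
    refine Finset.sum_le_sum fun w _ => ?_
    split_ifs with hw
    · rw [one_mul]
      refine hex w ?_
      rintro rfl
      linarith
    · norm_num
  -- Adding `ν_e B` makes every summand nonnegative, so a single arc is bounded by the whole sum.
  have hterm : ∀ e', 0 ≤ G.approxFlow n lam e' * ((if B < lam (G.tgt e') then (1 : ℝ) else 0) -
      if B < lam (G.src e') then (1 : ℝ) else 0) + G.ν e' * B := by
    intro e'
    have h2 := approxFlow_nonneg (G := G) (by linarith : 0 ≤ n) h0 e'
    have h3 : 0 ≤ G.ν e' * B := mul_nonneg (G.ν_pos e').le (by linarith)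
    split_ifs with h4 h5 h5
    · simpa using h3
    · linarith
    · have h6 : G.approxFlow n lam e' ≤ G.ν e' * B :=
        (approxFlow_le e').trans (mul_le_mul_of_nonneg_left (not_lt.1 h4) (G.ν_pos e').le)
      linarith
    · simpa using h3
  have hsingle := Finset.single_le_sum (fun e' _ => hterm e') (Finset.mem_univ e)
  rw [Finset.sum_add_distrib, hsum, ← Finset.sum_mul, if_pos htgt, if_neg (not_lt.2 hsrc)] at hsingle
  have h7 := le_approxFlow (G := G) hn h0 e
  have h8 := hcon _ htgt
  have h9 : G.ν e * ((K - 1) * B) < G.ν e * (lam (G.tgt e) - lam (G.src e)) :=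
    mul_lt_mul_of_pos_left (by linarith) (G.ν_pos e)
  have h10 := mul_le_mul_of_nonneg_right (hK e) (by linarith : 0 ≤ B)
  have h11 : (Fintype.card V : ℝ) ≤ Fintype.card V * B :=
    le_mul_of_one_le_right (Nat.cast_nonneg _) hB
  have h12 : 0 ≤ G.ν e * B := mul_nonneg (G.ν_pos e).le (by linarith)
  nlinarith

variable (G) in
-- Gaps between labels have bounded ratio: each window `(K^k, K^(k+1)]` contains a label until all
-- nodes are used up. `K` is chosen large enough for all arcs at once.
theorem exists_label_bound : ∃ B : ℝ, ∀ n : ℝ, 1 ≤ n → ∀ lam : V → ℝ, (∀ v, 0 ≤ lam v) →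
    lam G.s = 1 → (∀ v, v ≠ G.s → G.excess (G.approxFlow n lam) v ≤ 1) → ∀ v, lam v ≤ B := by
  classical
  set C := (∑ e, G.ν e) + Fintype.card V with hC
  have hC0 : 0 ≤ C := add_nonneg (Finset.sum_nonneg fun e _ => (G.ν_pos e).le) (Nat.cast_nonneg _)
  set K := 1 + ∑ e, C / G.ν e with hKdef
  have hdiv : ∀ e ∈ Finset.univ, 0 ≤ C / G.ν e := fun e _ => div_nonneg hC0 (G.ν_pos e).le
  have hK1 : 1 ≤ K := by linarith [Finset.sum_nonneg hdiv]
  have hK : ∀ e, C ≤ G.ν e * (K - 1) := by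
    intro e
    rw [← div_le_iff₀' (G.ν_pos e), hKdef, add_sub_cancel_left]
    exact Finset.single_le_sum hdiv (Finset.mem_univ e)
  refine ⟨K ^ Fintype.card V, fun n hn lam h0 hs hex => ?_⟩
  have hind : ∀ k : ℕ, (∀ v, lam v ≤ K ^ k) ∨
      k ≤ (Finset.univ.filter fun v => lam v ≤ K ^ k).card := by
    intro k
    induction k with
    | zero => exact Or.inr (Nat.zero_le _)
    | succ k ih =>
      have hpow : K ^ k ≤ K ^ (k + 1) := pow_le_pow_right₀ hK1 (Nat.le_succ k)
      by_cases hall : ∀ v, lam v ≤ K ^ k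
      · exact Or.inl fun v => (hall v).trans hpow
      · have ih := ih.resolve_left hall
        push Not at hall
        obtain ⟨v, hv⟩ := hall
        obtain ⟨w, hw1, hw2⟩ := exists_label_le_mul hn (one_le_pow₀ hK1) hK h0 hs hex hv
        rw [← pow_succ'] at hw2
        refine Or.inr (Nat.succ_le_of_lt (ih.trans_lt (Finset.card_lt_card ?_)))
        refine (Finset.ssubset_iff_of_subset fun u hu => ?_).2 ⟨w, by simpa using hw2, by simpa using hw1⟩
        simp only [Finset.mem_filter, Finset.mem_univ, true_and] at hu ⊢
        exact hu.trans hpow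
  rcases hind (Fintype.card V) with h | h
  · exact h
  · have := (Finset.card_eq_iff_eq_univ _).1 (le_antisymm (Finset.card_le_univ _) h)
    intro v
    have hv := Finset.mem_univ v
    rw [← this] at hv
    exact (Finset.mem_filter.1 hv).2

variable (G) in
-- Labels are bounded uniformly in `n`, so for large `n` none is capped, and every excess away from
-- `s` equals `1/n`, which vanishes in the limit. The cone conditions are the limits of the
-- definition of `approxFlow`.
theorem exists_coneFlow : ∃ y p, G.IsConeFlow y p := by
  classical
  obtain ⟨B, hB⟩ := G.exists_label_bound
  have hn1 : ∀ n : ℕ, (1 : ℝ) ≤ n + 1 := fun n => by linarith [(Nat.cast_nonneg n : (0 : ℝ) ≤ n)]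
  choose lam h0 hs hle heq using fun n : ℕ => exists_maximal_subsolution (G := G) (hn1 n)
  have hlamB : ∀ n v, lam n v ≤ B := fun n => hB _ (hn1 n) _ (h0 n) (hs n) fun v hv =>
    (hle n v hv).trans (inv_le_one_of_one_le₀ (hn1 n))
  set y : ℕ → E → ℝ := fun n => G.approxFlow (n + 1) (lam n) with hy
  have hy0 : ∀ n e, 0 ≤ y n e := fun n => approxFlow_nonneg (by linarith [hn1 n]) (h0 n)
  have hyle : ∀ n e, y n e ≤ G.ν e * lam n (G.tgt e) := fun n e => approxFlow_le e
  obtain ⟨φ, p, hφ, hp⟩ := exists_subseq_tendsto_of_abs_le lam B fun n v => by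
    rw [abs_of_nonneg (h0 n v)]; exact hlamB n v
  have hB0 : 0 ≤ B := (h0 0 G.s).trans (hlamB 0 G.s)
  obtain ⟨ψ, Y, hψ, hY⟩ := exists_subseq_tendsto_of_abs_le (fun n => y (φ n))
    (∑ e, G.ν e * B) fun n e => by
      rw [abs_of_nonneg (hy0 _ e)]
      refine (hyle _ e).trans ((mul_le_mul_of_nonneg_left (hlamB _ _) (G.ν_pos e).le).trans ?_)
      exact Finset.single_le_sum (f := fun e => G.ν e * B)
        (fun i _ => mul_nonneg (G.ν_pos i).le hB0) (Finset.mem_univ e)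
  have hp' : ∀ v, Tendsto (fun n => lam (φ (ψ n)) v) atTop (𝓝 (p v)) := fun v =>
    (hp v).comp hψ.tendsto_atTop
  have hidx : Tendsto (fun n => φ (ψ n)) atTop atTop := hφ.tendsto_atTop.comp hψ.tendsto_atTop
  have hidx' : Tendsto (fun n => ((φ (ψ n) : ℕ) : ℝ) + 1) atTop atTop :=
    tendsto_atTop_add_const_right _ _ (tendsto_natCast_atTop_atTop.comp hidx)
  have hps : p G.s = 1 := tendsto_nhds_unique (hp' G.s) (by simp [hs])
  have hp0 : ∀ v, 0 ≤ p v := fun v => ge_of_tendsto' (hp' v) fun n => h0 _ v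
  have hev : ∀ᶠ n in atTop, ∀ v, v ≠ G.s →
      G.excess (y (φ (ψ n))) v = ((φ (ψ n) : ℝ) + 1)⁻¹ := by
    filter_upwards [hidx'.eventually_gt_atTop B] with n hn v hv
    exact heq _ v hv ((hlamB _ v).trans_lt hn)
  have hexv : ∀ v, Tendsto (fun n => G.excess (y (φ (ψ n))) v) atTop (𝓝 (G.excess Y v)) :=
    fun v => ((continuous_excess v).tendsto Y).comp (tendsto_pi_nhds.2 hY)
  have hex0 : ∀ v, v ≠ G.s → G.excess Y v = 0 := by
    intro v hv
    refine tendsto_nhds_unique (hexv v) (hidx'.inv_tendsto_atTop.congr' ?_)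
    filter_upwards [hev] with n hn
    exact (hn v hv).symm
  have hcirc : G.IsCirculation Y := by
    refine isCirculation_iff_excess.2 fun v => ?_
    by_cases hv : v = G.s
    · subst hv
      have hsum := sum_mul_sub_eq_excess (G := G) Y (fun _ => 1)
      rw [Finset.sum_eq_single G.s (fun v _ hv => by rw [hex0 v hv, mul_zero]) (by simp)] at hsum
      simpa using hsum.symm
    · exact hex0 v hv
  have hYle : ∀ e, Y e ≤ G.ν e * p (G.tgt e) := fun e =>
    le_of_tendsto_of_tendsto' (hY e) ((hp' _).const_mul _) fun n => hyle _ e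
  have hact : ∀ᶠ n in atTop, {e | 0 < y (φ (ψ n)) e} ⊆ G.coneActive p := by
    have : ∀ᶠ n in atTop, ∀ e, e ∉ G.coneActive p → y (φ (ψ n)) e = 0 := by
      refine eventually_all.2 fun e => ?_
      by_cases he : e ∈ G.coneActive p
      · exact Eventually.of_forall fun n h => absurd he h
      · have he' := he
        simp only [coneActive, Set.mem_ofPred_eq, not_or, not_le] at he'
        filter_upwards [(hp' _).eventually_lt (hp' _) he'.2] with n hn _
        exact approxFlow_eq_zero (h0 _) he'.1 hn.le
    filter_upwards [this] with n hn e he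
    by_contra hc
    exact (show 0 < y (φ (ψ n)) e from he).ne' (hn e hc)
  have hreach : ∀ v, G.Reaches (G.coneActive p) G.s v := by
    obtain ⟨n, hn1, hn2⟩ := (hev.and hact).exists
    intro v
    refine Reaches.mono hn2 ?_
    -- A set not reached by flow-carrying arcs has no inflow, yet the excess at each of its nodes is
    -- strictly positive.
    by_contra hv
    set T : Set V := {v | ¬ G.Reaches {e | 0 < y (φ (ψ n)) e} G.s v} with hT
    have hsT : G.s ∉ T := by
      simp only [hT, Set.mem_ofPred_eq, not_not]
      exact Relation.ReflTransGen.refl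
    have hent : ∀ e, G.src e ∉ T → G.tgt e ∈ T → y (φ (ψ n)) e = 0 := by
      intro e h1 h2
      by_contra h3
      simp only [hT, Set.mem_ofPred_eq, not_not] at h1 h2
      exact h2 (Relation.ReflTransGen.tail h1
        ⟨e, lt_of_le_of_ne (hy0 _ e) (Ne.symm h3), rfl, rfl⟩)
    have hsum := sum_mul_sub_eq_excess (G := G) (y (φ (ψ n))) (fun v => if v ∈ T then 1 else 0)
    have hneg : ∑ e, y (φ (ψ n)) e * ((if G.tgt e ∈ T then (1 : ℝ) else 0) -
        if G.src e ∈ T then 1 else 0) ≤ 0 := by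
      refine Finset.sum_nonpos fun e _ => ?_
      have h4 := hy0 (φ (ψ n)) e
      split_ifs with h1 h2 h2
      · simp
      · rw [hent e h2 h1]; simp
      · linarith
      · simp
    have hpos : 0 < ∑ v, (if v ∈ T then (1 : ℝ) else 0) * G.excess (y (φ (ψ n))) v := by
      have h5 : (0 : ℝ) < ((φ (ψ n) : ℝ) + 1)⁻¹ := by positivity
      refine Finset.sum_pos' (fun w _ => ?_) ⟨v, Finset.mem_univ v, ?_⟩
      · split_ifs with hw
        · rw [hn1 w (by rintro rfl; exact hsT hw)]
          linarith
        · simp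
      · have hvT : v ∈ T := hv
        rw [if_pos hvT, hn1 v (by rintro rfl; exact hsT hvT)]
        linarith
    linarith
  refine ⟨Y, p, fun e he => Or.inl he, fun e he => he.imp id le_of_lt, hreach, hcirc,
    fun e => ge_of_tendsto' (hY e) fun n => hy0 _ e, hp0, hps, fun e he => ?_, fun e he => ?_, hYle,
    fun e hA hR => ?_⟩
  · simp only [coneActive, Set.mem_ofPred_eq, not_or, not_le] at he
    refine tendsto_nhds_unique (hY e) (tendsto_const_nhds.congr' ?_)
    filter_upwards [(hp' _).eventually_lt (hp' _) he.2] with n hn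
    exact (approxFlow_eq_zero (h0 _) he.1 hn.le).symm
  · refine tendsto_nhds_unique (hY e) (((hp' _).const_mul _).congr' ?_)
    by_cases hf : e ∈ G.free
    · exact Eventually.of_forall fun n => (approxFlow_free hf).symm
    · have hlt := he.resolve_left hf
      have h1 : Tendsto (fun n => lam (φ (ψ n)) (G.tgt e) - lam (φ (ψ n)) (G.src e)) atTop
          (𝓝 (p (G.tgt e) - p (G.src e))) := (hp' _).sub (hp' _)
      -- The steep factor drives the second entry of the minimum to infinity, so the first one is
      -- selected.
      have h2 := hidx'.atTop_mul_pos (sub_pos.2 hlt) h1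
      filter_upwards [h2.eventually_ge_atTop B, h1.eventually_const_lt (sub_pos.2 hlt)] with n hn hn'
      simp only [hy, approxFlow, if_neg hf]
      rw [max_eq_left hn'.le, min_eq_left ((hlamB _ _).trans hn)]
  · simp only [coneResetting, Set.mem_ofPred_eq, not_or, not_lt] at hR
    exact le_antisymm hR.2 (hA.resolve_left hR.1)

end Finite

end GeneralizedNetwork

/-! ### Absolute continuity and derivatives of positive parts -/

theorem AbsolutelyContinuousOnInterval.lipschitzOnWith_comp {f : ℝ → ℝ} {a b : ℝ}
    (hf : AbsolutelyContinuousOnInterval f a b) {g : ℝ → ℝ} {s : Set ℝ} {K : NNReal}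
    (hg : LipschitzOnWith K g s) (hs : ∀ t ∈ Set.uIcc a b, f t ∈ s) :
    AbsolutelyContinuousOnInterval (fun t => g (f t)) a b := by
  rw [absolutelyContinuousOnInterval_iff] at hf ⊢
  intro ε hε
  -- `K + 1` instead of `K` permits division when the Lipschitz constant is zero.
  have hK : (0 : ℝ) < K + 1 := by positivity
  obtain ⟨δ, hδ, h⟩ := hf (ε / (K + 1)) (by positivity)
  refine ⟨δ, hδ, fun I hI hlt => ?_⟩
  calc ∑ i ∈ Finset.range I.1, dist (g (f (I.2 i).1)) (g (f (I.2 i).2))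
      ≤ ∑ i ∈ Finset.range I.1, (K + 1 : ℝ) * dist (f (I.2 i).1) (f (I.2 i).2) := by
        refine Finset.sum_le_sum fun i hi => ?_
        refine (hg.dist_le_mul _ (hs _ (hI.1 i hi).1) _ (hs _ (hI.1 i hi).2)).trans ?_
        gcongr
        linarith
    _ = (K + 1) * ∑ i ∈ Finset.range I.1, dist (f (I.2 i).1) (f (I.2 i).2) := by
        rw [Finset.mul_sum]
    _ < (K + 1) * (ε / (K + 1)) := by
        gcongr
        exact h I hI hlt
    _ = ε := by field_simp

theorem AbsolutelyContinuousOnInterval.max_zero {f : ℝ → ℝ} {a b : ℝ}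
    (hf : AbsolutelyContinuousOnInterval f a b) :
    AbsolutelyContinuousOnInterval (fun t => max 0 (f t)) a b :=
  hf.lipschitzOnWith_comp (g := fun u => max 0 u) (s := Set.univ) (K := 1)
    (LipschitzWith.id.const_max 0).lipschitzOnWith fun _ _ => Set.mem_univ _

theorem AbsolutelyContinuousOnInterval.log {f : ℝ → ℝ} {a b c : ℝ} (hc : 0 < c)
    (hf : AbsolutelyContinuousOnInterval f a b) (h : ∀ t ∈ Set.uIcc a b, c ≤ f t) :
    AbsolutelyContinuousOnInterval (fun t => Real.log (f t)) a b := by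
  refine hf.lipschitzOnWith_comp (s := Set.Ici c) (K := ⟨c⁻¹, by positivity⟩) ?_ h
  refine LipschitzOnWith.of_le_add_mul _ fun u hu v hv => ?_
  have hu : c ≤ u := hu
  have hv : c ≤ v := hv
  have hu0 : 0 < u := by linarith
  have hv0 : 0 < v := by linarith
  have h1 := Real.log_le_sub_one_of_pos (div_pos hu0 hv0)
  rw [Real.log_div hu0.ne' hv0.ne'] at h1
  have h2 : u / v - 1 ≤ c⁻¹ * dist u v := by
    rw [div_sub_one hv0.ne', div_eq_inv_mul, Real.dist_eq]
    have h3 : v⁻¹ ≤ c⁻¹ := inv_anti₀ hc hv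
    exact (mul_le_mul_of_nonneg_left (le_abs_self _) (inv_nonneg.2 hv0.le)).trans
      (mul_le_mul_of_nonneg_right h3 (abs_nonneg _))
  change Real.log u ≤ Real.log v + c⁻¹ * dist u v
  linarith

theorem AbsolutelyContinuousOnInterval.const (c a b : ℝ) :
    AbsolutelyContinuousOnInterval (fun _ : ℝ => c) a b :=
  ((LipschitzWith.const c).lipschitzOnWith (s := Set.uIcc a b)).absolutelyContinuousOnInterval

theorem AbsolutelyContinuousOnInterval.sum {ι : Type*} {s : Finset ι} {f : ι → ℝ → ℝ} {a b : ℝ}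
    (h : ∀ i ∈ s, AbsolutelyContinuousOnInterval (f i) a b) :
    AbsolutelyContinuousOnInterval (fun t => ∑ i ∈ s, f i t) a b := by
  classical
  induction s using Finset.induction_on with
  | empty => simpa using AbsolutelyContinuousOnInterval.const 0 a b
  | insert i s hi ih =>
    simp only [Finset.sum_insert hi]
    exact (h i (Finset.mem_insert_self i s)).fun_add
      (ih fun j hj => h j (Finset.mem_insert_of_mem hj))

theorem AbsolutelyContinuousOnInterval.sub_le_mul {f : ℝ → ℝ} {a b c : ℝ} (hab : a ≤ b)
    (hf : AbsolutelyContinuousOnInterval f a b)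
    (h : ∀ᵐ t : ℝ, t ∈ Set.Icc a b → deriv f t ≤ c) : f b - f a ≤ c * (b - a) := by
  rw [← hf.integral_deriv_eq_sub]
  have := intervalIntegral.integral_mono_ae_restrict hab hf.intervalIntegrable_deriv
    (intervalIntegrable_const (c := c)) ((ae_restrict_iff' measurableSet_Icc).2 h)
  refine this.trans ?_
  rw [intervalIntegral.integral_const, smul_eq_mul, mul_comm]

theorem AbsolutelyContinuousOnInterval.mul_le_sub {f : ℝ → ℝ} {a b c : ℝ} (hab : a ≤ b)
    (hf : AbsolutelyContinuousOnInterval f a b)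
    (h : ∀ᵐ t : ℝ, t ∈ Set.Icc a b → c ≤ deriv f t) : c * (b - a) ≤ f b - f a := by
  have h1 := hf.fun_neg.sub_le_mul (c := -c) hab (h.mono fun t ht hm => by
    rw [deriv.fun_neg]
    exact neg_le_neg (ht hm))
  linarith

/-- The derivative vanishes almost everywhere on the zero set of a function. -/
theorem ae_deriv_eq_zero_of_eq_zero (f : ℝ → ℝ) : ∀ᵐ t : ℝ, f t = 0 → deriv f t = 0 := by
  -- Zeros isolated from the right are countably many. At every other zero, a nonzero derivative
  -- would exclude nearby zeros.
  have hc := countable_setOfPred_isolated_right_within (s := {t : ℝ | f t = 0})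
  filter_upwards [hc.ae_notMem volume] with t ht h0
  by_contra hd
  refine ht ⟨h0, ?_⟩
  have h1 := (differentiableAt_of_deriv_ne_zero hd).hasDerivAt.eventually_ne (c := 0) hd
  rw [← Filter.empty_mem_iff_bot]
  have h2 : {z | f z ≠ 0} ∈ 𝓝[{t | f t = 0} ∩ Set.Ioi t] t :=
    nhdsWithin_mono t (fun z hz => ne_of_gt hz.2) h1
  filter_upwards [h2, self_mem_nhdsWithin] with z hz hz'
  exact hz hz'.1

/-- The hypothesis removes the kink: at a zero of `f` the derivative vanishes, and the positive part
is dominated by `f`. -/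
theorem hasDerivAt_max_zero {f : ℝ → ℝ} {f' t : ℝ} (hf : HasDerivAt f f' t)
    (h0 : f t = 0 → f' = 0) :
    HasDerivAt (fun u => max 0 (f u)) (if 0 < f t then f' else 0) t := by
  rcases lt_trichotomy (f t) 0 with h | h | h
  · rw [if_neg (not_lt.2 h.le)]
    refine (hasDerivAt_const t (0 : ℝ)).congr_of_eventuallyEq ?_
    filter_upwards [hf.continuousAt.eventually_lt continuousAt_const h] with u hu
    exact max_eq_left hu.le
  · rw [if_neg (not_lt.2 h.le)]
    rw [h0 h, hasDerivAt_iff_isLittleO] at hf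
    rw [hasDerivAt_iff_isLittleO]
    refine Asymptotics.IsBigO.trans_isLittleO (Asymptotics.isBigO_of_le _ fun u => ?_) hf
    simp only [h, max_self, smul_zero, sub_zero, Real.norm_eq_abs]
    rcases le_total (f u) 0 with hu | hu
    · rw [max_eq_left hu]; simp
    · rw [max_eq_right hu]
  · rw [if_pos h]
    refine hf.congr_of_eventuallyEq ?_
    filter_upwards [continuousAt_const.eventually_lt hf.continuousAt h] with u hu
    exact max_eq_right hu.le

/-! ### Dissipation, and Nash flows at regular times -/

namespace GeneralizedNetwork

variable {V E : Type*} {G : GeneralizedNetwork V E} [Fintype E]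

open Classical in
/-- Dissipation of the labels' rates `lam` for the target ratios `k` along resetting arcs. -/
noncomputable def dissipation (G : GeneralizedNetwork V E) (R : Set E) (k : E → ℝ) (lam : V → ℝ) :
    ℝ :=
  ∑ e with e ∈ R, G.ν e * (√(lam (G.tgt e)) - √(k e * lam (G.src e))) ^ 2

theorem dissipation_nonneg (R : Set E) (k : E → ℝ) (lam : V → ℝ) :
    0 ≤ G.dissipation R k lam :=
  Finset.sum_nonneg fun e _ => mul_nonneg (G.ν_pos e).le (sq_nonneg _)

theorem le_dissipation {R : Set E} (k : E → ℝ) (lam : V → ℝ) {e : E} (he : e ∈ R) :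
    G.ν e * (√(lam (G.tgt e)) - √(k e * lam (G.src e))) ^ 2 ≤ G.dissipation R k lam := by
  classical
  exact Finset.single_le_sum
    (f := fun e => G.ν e * (√(lam (G.tgt e)) - √(k e * lam (G.src e))) ^ 2)
    (fun e _ => mul_nonneg (G.ν_pos e).le (sq_nonneg _)) (by simpa using he)

/-- This is `log u ≤ u - 1` at `u = √(k a) / √b`, multiplied by `2 b`. The square roots make the
deficit a perfect square. -/
theorem sub_add_log_add_sq_le {a b k : ℝ} (ha : 0 < a) (hb : 0 < b) (hk : 0 < k) :
    (b - k * a) + b * Real.log k + (√b - √(k * a)) ^ 2 ≤ b * (Real.log b - Real.log a) := by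
  have hka : 0 < k * a := mul_pos hk ha
  have hsb := Real.sqrt_pos.2 hb
  have hsa := Real.sqrt_pos.2 hka
  have h1 := Real.log_le_sub_one_of_pos (div_pos hsa hsb)
  rw [Real.log_div hsa.ne' hsb.ne', Real.log_sqrt hka.le, Real.log_sqrt hb.le,
    Real.log_mul hk.ne' ha.ne'] at h1
  have h2 := mul_le_mul_of_nonneg_left h1 hb.le
  have h3 : b * (√(k * a) / √b - 1) = √b * √(k * a) - b := by
    rw [mul_sub, mul_one]
    congr 1
    rw [mul_div_assoc']
    rw [div_eq_iff hsb.ne']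
    nlinarith [Real.mul_self_sqrt hb.le]
  have h4 := Real.sq_sqrt hb.le
  have h5 := Real.sq_sqrt hka.le
  nlinarith

open Classical in
-- Sum `sub_add_log_add_sq_le` over the resetting arcs with `a = lam_v`, `b = lam_w`. The
-- logarithmic right sides add up to zero: they pair the circulation with a potential, and
-- non-resetting arcs contribute nothing.
theorem IsTight.sum_le_neg_dissipation [Fintype V] {A R : Set E} {y : E → ℝ} {lam : V → ℝ}
    (h : G.IsTight A R y lam) {k : E → ℝ} (hk : ∀ e ∈ R, 0 < k e) :
    ∑ e with e ∈ R, (G.ν e * (lam (G.tgt e) - k e * lam (G.src e)) + y e * Real.log (k e)) ≤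
      -G.dissipation R k lam := by
  have hlog : ∑ e with e ∈ R, y e * (Real.log (lam (G.tgt e)) - Real.log (lam (G.src e))) = 0 := by
    rw [← h.circulation.sum_mul_sub fun v => Real.log (lam v)]
    refine Finset.sum_subset (Finset.subset_univ _) fun e _ he => ?_
    have he : e ∉ R := by simpa using he
    by_cases hA : e ∈ A
    · rw [h.label_eq e hA he, sub_self, mul_zero]
    · rw [h.flow_eq_zero e hA, zero_mul]
  rw [← sub_nonpos, sub_neg_eq_add, dissipation, ← Finset.sum_add_distrib, ← hlog]
  refine Finset.sum_le_sum fun e he => ?_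
  have he : e ∈ R := by simpa using he
  have hy := h.flow_eq e he
  have hν := G.ν_pos e
  -- Label rates may vanish here. Then `y e = 0`, so the value of the logarithm at zero is
  -- immaterial.
  rcases (h.label_nonneg (G.src e)).eq_or_lt with hv | hv
  · have hy0 := h.circulation.flow_eq_zero_of_label h.flow_nonneg h.flow_le hv.symm
    rw [hy0] at hy
    have hw : lam (G.tgt e) = 0 := by
      rcases mul_eq_zero.1 hy.symm with h1 | h1
      · exact absurd h1 hν.ne'
      · exact h1
    simp [hy0, hw, ← hv]
  rcases (h.label_nonneg (G.tgt e)).eq_or_lt with hw | hw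
  · rw [← hw, mul_zero] at hy
    have h1 := Real.sq_sqrt (mul_pos (hk e he) hv).le
    have h2 : (0 - √(k e * lam (G.src e))) ^ 2 = k e * lam (G.src e) := by
      rw [zero_sub, neg_sq, h1]
    rw [hy, ← hw, Real.sqrt_zero, h2]
    exact le_of_eq (by ring)
  · have h1 := mul_le_mul_of_nonneg_left (sub_add_log_add_sq_le hv hw (hk e he)) hν.le
    rw [hy]
    nlinarith

/-- Times at which the flow over time is differentiable with tight derivatives. -/
structure RegularAt (G : GeneralizedNetwork V E) (x : E → ℝ → ℝ) (ℓ : V → ℝ → ℝ) (θ : ℝ) :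
    Prop where
  tight : G.IsTight (G.active fun u => ℓ u θ) (G.resetting fun u => ℓ u θ)
    (fun e => deriv (x e) θ) (fun v => deriv (ℓ v) θ)
  flow : ∀ e, HasDerivAt (x e) (deriv (x e) θ) θ
  label : ∀ v, HasDerivAt (ℓ v) (deriv (ℓ v) θ) θ

theorem ae_hasDerivAt_of_forall {f : ℝ → ℝ}
    (hf : ∀ T, 0 < T → AbsolutelyContinuousOnInterval f 0 T) :
    ∀ᵐ θ : ℝ, 0 ≤ θ → HasDerivAt f (deriv f θ) θ := by
  have h : ∀ n : ℕ, ∀ᵐ θ : ℝ, θ ∈ Set.uIcc 0 ((n : ℝ) + 1) → DifferentiableAt ℝ f θ :=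
    fun n => (hf _ (by positivity)).ae_differentiableAt
  filter_upwards [ae_all_iff.2 h] with θ hθ h0
  obtain ⟨n, hn⟩ := exists_nat_ge θ
  refine (hθ n ?_).hasDerivAt
  rw [Set.uIcc_of_le (by positivity)]
  exact ⟨h0, by linarith⟩

/-- The minimum condition gives `lam_w ≤ y_e / ν_e` on resetting arcs, and its attainment by
flow-carrying arcs gives the converse bound. Only the equality on active non-resetting arcs needs
`heq`. -/
theorem IsThinFlow.isTight {l : V → ℝ} {y : E → ℝ} {lam : V → ℝ}
    (h : G.IsThinFlow (G.active l) (G.resetting l) y lam)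
    (hr : ∀ v, G.Reaches (G.active l) G.s v)
    (heq : ∀ e, l (G.tgt e) = l (G.src e) + G.τ e → lam (G.tgt e) = lam (G.src e)) :
    G.IsTight (G.active l) (G.resetting l) y lam := by
  have hdiv : ∀ e, 0 ≤ y e / G.ν e := fun e => div_nonneg (h.nonneg e) (G.ν_pos e).le
  have hlam : ∀ w, 0 ≤ lam w := by
    intro w
    obtain ⟨e, -, -, he⟩ := (h.label_min w).1
    rw [he, rho]
    split_ifs
    · exact hdiv e
    · exact (hdiv e).trans (le_max_right _ _)
  have hsub : G.resetting l ⊆ G.active l := fun e he => he.imp id le_of_lt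
  have hle : ∀ e, y e ≤ G.ν e * lam (G.tgt e) := by
    intro e
    rcases (h.nonneg e).eq_or_lt with h0 | h0
    · rw [← h0]
      exact mul_nonneg (G.ν_pos e).le (hlam _)
    · have hA : e ∈ G.active l := by
        by_contra hA
        exact h0.ne' (h.support e hA)
      rw [← div_le_iff₀' (G.ν_pos e), h.label_flow e hA h0, rho]
      split_ifs
      · exact le_rfl
      · exact le_max_right _ _
  refine ⟨fun e he => Or.inl he, hsub, hr, h.circulation, h.nonneg, hlam, h.label_source, h.support,
    fun e he => le_antisymm (hle e) ?_, hle, fun e hA hR => ?_⟩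
  · rw [← le_div_iff₀' (G.ν_pos e)]
    refine (h.label_min (G.tgt e)).2 ⟨e, hsub he, rfl, ?_⟩
    rw [rho, if_pos he]
  · simp only [resetting, Set.mem_ofPred_eq, not_or, not_lt] at hR
    exact heq e (le_antisymm hR.2 (hA.resolve_left hR.1))

theorem RegularAt.hasDerivAt_max_zero {x : E → ℝ → ℝ} {ℓ : V → ℝ → ℝ} {θ : ℝ}
    (hr : G.RegularAt x ℓ θ) {e : E} (he : e ∉ G.free) :
    HasDerivAt (fun t => max 0 (ℓ (G.tgt e) t - ℓ (G.src e) t - G.τ e))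
      (if 0 < ℓ (G.tgt e) θ - ℓ (G.src e) θ - G.τ e then
        deriv (ℓ (G.tgt e)) θ - deriv (ℓ (G.src e)) θ else 0) θ := by
  refine _root_.hasDerivAt_max_zero (f := fun t => ℓ (G.tgt e) t - ℓ (G.src e) t - G.τ e)
    (((hr.label _).fun_sub (hr.label _)).sub_const _) fun h0 => ?_
  rw [sub_eq_zero]
  refine hr.tight.label_eq e (Or.inr (by linarith)) ?_
  rintro (h1 | h1)
  · exact he h1
  · linarith

variable (G) in
-- Finitely many labels are bounded, and the capacity inequality passes the bound to flows.
theorem exists_rate_bound [Fintype V] : ∃ K : ℝ, 1 ≤ K ∧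
    (∀ A R y lam, G.IsTight A R y lam → ∀ v, lam v ≤ K) ∧
    (∀ A R y lam, G.IsTight A R y lam → ∀ e, y e ≤ K) := by
  have hfin : ∀ v, ((fun lam : V → ℝ => lam v) ''
      {lam : V → ℝ | ∃ A R y, G.IsTight A R y lam}).Finite :=
    fun v => G.finite_tight_labels.image _
  choose K hK using fun v => (hfin v).bddAbove
  have hK' : ∀ A R y lam, G.IsTight A R y lam → ∀ v, lam v ≤ K v := fun A R y lam h v =>
    hK v ⟨lam, ⟨A, R, y, h⟩, rfl⟩
  have h1 : ∀ v, |K v| ≤ ∑ v, |K v| := fun v =>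
    Finset.single_le_sum (f := fun v => |K v|) (fun v _ => abs_nonneg _) (Finset.mem_univ v)
  have h2 : ∀ e, |G.ν e * K (G.tgt e)| ≤ ∑ e, |G.ν e * K (G.tgt e)| := fun e =>
    Finset.single_le_sum (f := fun e => |G.ν e * K (G.tgt e)|) (fun v _ => abs_nonneg _)
      (Finset.mem_univ e)
  have h3 : 0 ≤ ∑ v, |K v| := Finset.sum_nonneg fun v _ => abs_nonneg _
  have h4 : 0 ≤ ∑ e, |G.ν e * K (G.tgt e)| := Finset.sum_nonneg fun v _ => abs_nonneg _
  refine ⟨1 + ∑ v, |K v| + ∑ e, |G.ν e * K (G.tgt e)|, by linarith, fun A R y lam h v => ?_,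
    fun A R y lam h e => ?_⟩
  · linarith [hK' A R y lam h v, h1 v, le_abs_self (K v)]
  · have h5 := mul_le_mul_of_nonneg_left (hK' A R y lam h (G.tgt e)) (G.ν_pos e).le
    linarith [h.flow_le e, h2 e, le_abs_self (G.ν e * K (G.tgt e))]

/-! ### Integrated estimates for Nash flows -/

namespace IsNashFlow

variable {x : E → ℝ → ℝ} {ℓ : V → ℝ → ℝ}

theorem flow_ac_on (h : G.IsNashFlow x ℓ) (e : E) {a b : ℝ} (ha : 0 ≤ a) (hab : a ≤ b) :
    AbsolutelyContinuousOnInterval (x e) a b := by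
  refine (h.flow_ac e (b + 1) (by linarith)).mono ?_
  rw [Set.uIcc_of_le hab, Set.uIcc_of_le (by linarith)]
  exact Set.Icc_subset_Icc ha (by linarith)

theorem label_ac_on (h : G.IsNashFlow x ℓ) (v : V) {a b : ℝ} (ha : 0 ≤ a) (hab : a ≤ b) :
    AbsolutelyContinuousOnInterval (ℓ v) a b := by
  refine (h.label_ac v (b + 1) (by linarith)).mono ?_
  rw [Set.uIcc_of_le hab, Set.uIcc_of_le (by linarith)]
  exact Set.Icc_subset_Icc ha (by linarith)

variable [Fintype V]

/-- Tightness holds because the derivative of `ℓ_w - ℓ_v - τ_e` vanishes almost everywhere on its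
zero set. -/
theorem ae_regular (h : G.IsNashFlow x ℓ) : ∀ᵐ θ : ℝ, 0 ≤ θ → G.RegularAt x ℓ θ := by
  have h1 := ae_all_iff.2 fun e => ae_hasDerivAt_of_forall (h.flow_ac e)
  have h2 := ae_all_iff.2 fun v => ae_hasDerivAt_of_forall (h.label_ac v)
  have h3 := ae_all_iff.2 fun e =>
    ae_deriv_eq_zero_of_eq_zero fun θ => ℓ (G.tgt e) θ - (ℓ (G.src e) θ + G.τ e)
  filter_upwards [h1, h2, h3, h.thin] with θ h1 h2 h3 h4 h0
  refine ⟨(h4 h0).isTight (h.reaches θ h0) fun e he => ?_, fun e => h1 e h0, fun v => h2 v h0⟩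
  have h5 := h3 e (sub_eq_zero.2 he)
  rw [((h2 (G.tgt e) h0).fun_sub ((h2 (G.src e) h0).add_const (G.τ e))).deriv] at h5
  linarith

theorem ae_regular_Icc (h : G.IsNashFlow x ℓ) {a b : ℝ} (ha : 0 ≤ a) {p : ℝ → Prop}
    (hp : ∀ θ ∈ Set.Icc a b, G.RegularAt x ℓ θ → p θ) : ∀ᵐ θ : ℝ, θ ∈ Set.Icc a b → p θ :=
  h.ae_regular.mono fun θ hθ hm => hp θ hm (hθ (ha.trans hm.1))

theorem label_mono (h : G.IsNashFlow x ℓ) (v : V) {a b : ℝ} (ha : 0 ≤ a) (hab : a ≤ b) :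
    ℓ v a ≤ ℓ v b := by
  have := (h.label_ac_on v ha hab).mul_le_sub hab
    (h.ae_regular_Icc ha fun θ _ hr => hr.tight.label_nonneg v)
  linarith

theorem label_sub_le (h : G.IsNashFlow x ℓ) {K : ℝ}
    (hK : ∀ A R y lam, G.IsTight A R y lam → ∀ v, lam v ≤ K) (v : V) {a b : ℝ} (ha : 0 ≤ a)
    (hab : a ≤ b) : ℓ v b - ℓ v a ≤ K * (b - a) :=
  (h.label_ac_on v ha hab).sub_le_mul hab
    (h.ae_regular_Icc ha fun _ _ hr => hK _ _ _ _ hr.tight v)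

theorem flow_mono (h : G.IsNashFlow x ℓ) (e : E) {a b : ℝ} (ha : 0 ≤ a) (hab : a ≤ b) :
    x e a ≤ x e b := by
  have := (h.flow_ac_on e ha hab).mul_le_sub hab
    (h.ae_regular_Icc ha fun θ _ hr => hr.tight.flow_nonneg e)
  linarith

theorem flow_sub_le (h : G.IsNashFlow x ℓ) {K : ℝ}
    (hK : ∀ A R y lam, G.IsTight A R y lam → ∀ e, y e ≤ K) (e : E) {a b : ℝ} (ha : 0 ≤ a)
    (hab : a ≤ b) : x e b - x e a ≤ K * (b - a) :=
  (h.flow_ac_on e ha hab).sub_le_mul hab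
    (h.ae_regular_Icc ha fun _ _ hr => hK _ _ _ _ hr.tight e)

theorem label_source_sub (h : G.IsNashFlow x ℓ) {a b : ℝ} (ha : 0 ≤ a) (hab : a ≤ b) :
    ℓ G.s b - ℓ G.s a = b - a := by
  have h1 := (h.label_ac_on G.s ha hab).mul_le_sub hab
    (h.ae_regular_Icc ha fun θ _ hr => hr.tight.label_source.ge)
  have h2 := (h.label_ac_on G.s ha hab).sub_le_mul hab
    (h.ae_regular_Icc ha fun θ _ hr => hr.tight.label_source.le)
  linarith

theorem flow_sub_le_label_sub (h : G.IsNashFlow x ℓ) (e : E) {a b : ℝ} (ha : 0 ≤ a)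
    (hab : a ≤ b) : x e b - x e a ≤ G.ν e * (ℓ (G.tgt e) b - ℓ (G.tgt e) a) := by
  have h1 := ((h.flow_ac_on e ha hab).fun_sub
    ((h.label_ac_on (G.tgt e) ha hab).const_mul (G.ν e))).sub_le_mul (c := 0) hab
    (h.ae_regular_Icc ha fun θ _ hr => by
      rw [((hr.flow e).fun_sub ((hr.label (G.tgt e)).const_mul (G.ν e))).deriv]
      linarith [hr.tight.flow_le e])
  linarith

theorem flow_sub_eq_of_free (h : G.IsNashFlow x ℓ) {e : E} (he : e ∈ G.free) {a b : ℝ}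
    (ha : 0 ≤ a) (hab : a ≤ b) : x e b - x e a = G.ν e * (ℓ (G.tgt e) b - ℓ (G.tgt e) a) := by
  refine le_antisymm (h.flow_sub_le_label_sub e ha hab) ?_
  have h1 := ((h.flow_ac_on e ha hab).fun_sub
    ((h.label_ac_on (G.tgt e) ha hab).const_mul (G.ν e))).mul_le_sub (c := 0) hab
    (h.ae_regular_Icc ha fun θ _ hr => by
      rw [((hr.flow e).fun_sub ((hr.label (G.tgt e)).const_mul (G.ν e))).deriv]
      linarith [hr.tight.flow_eq e (Or.inl he)])
  linarith

/-- While positive, the queue grows at rate `λ_w - λ_v ≤ λ_w = y_e / ν_e`; otherwise its rate is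
zero. -/
theorem queue_sub_le_flow_sub (h : G.IsNashFlow x ℓ) {e : E} (he : e ∉ G.free) {a b : ℝ}
    (ha : 0 ≤ a) (hab : a ≤ b) :
    G.ν e * (max 0 (ℓ (G.tgt e) b - ℓ (G.src e) b - G.τ e) -
      max 0 (ℓ (G.tgt e) a - ℓ (G.src e) a - G.τ e)) ≤ x e b - x e a := by
  have hac := (((h.label_ac_on (G.tgt e) ha hab).fun_sub (h.label_ac_on (G.src e) ha hab)).fun_sub
    (AbsolutelyContinuousOnInterval.const (G.τ e) a b)).max_zero
  have h1 := ((h.flow_ac_on e ha hab).fun_sub (hac.const_mul (G.ν e))).mul_le_sub (c := 0) hab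
    (h.ae_regular_Icc ha fun θ _ hr => by
      rw [((hr.flow e).fun_sub ((hr.hasDerivAt_max_zero he).const_mul (G.ν e))).deriv]
      split_ifs with h0
      · have h2 := hr.tight.flow_eq e (Or.inr (by linarith))
        have h3 := mul_nonneg (G.ν_pos e).le (hr.tight.label_nonneg (G.src e))
        rw [h2]
        linarith
      · simpa using hr.tight.flow_nonneg e)
  linarith

theorem isCirculation_sub (h : G.IsNashFlow x ℓ) {a b : ℝ} (ha : 0 ≤ a) (hab : a ≤ b) :
    G.IsCirculation fun e => x e b - x e a := by
  classical
  refine isCirculation_iff_excess.2 fun v => ?_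
  have hac := (AbsolutelyContinuousOnInterval.sum (s := Finset.univ.filter fun e => G.tgt e = v)
    fun e _ => h.flow_ac_on e ha hab).fun_sub
    (AbsolutelyContinuousOnInterval.sum (s := Finset.univ.filter fun e => G.src e = v)
    fun e _ => h.flow_ac_on e ha hab)
  have hd : ∀ θ, G.RegularAt x ℓ θ → deriv (fun t => ∑ e with G.tgt e = v, x e t -
      ∑ e with G.src e = v, x e t) θ = 0 := by
    intro θ hr
    rw [((HasDerivAt.fun_sum fun e _ => hr.flow e).fun_sub
      (HasDerivAt.fun_sum fun e _ => hr.flow e)).deriv]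
    have := isCirculation_iff_excess.1 hr.tight.circulation v
    unfold excess at this
    convert this
  have h1 := hac.mul_le_sub (c := 0) hab (h.ae_regular_Icc ha fun θ _ hr => (hd θ hr).ge)
  have h2 := hac.sub_le_mul (c := 0) hab (h.ae_regular_Icc ha fun θ _ hr => (hd θ hr).le)
  unfold excess
  simp only [Finset.sum_sub_distrib]
  have h3 : ∑ e with G.tgt e = v, x e b - ∑ e with G.src e = v, x e b -
    (∑ e with G.tgt e = v, x e a - ∑ e with G.src e = v, x e a) = 0 := by linarith
  linear_combination (exp := 1) h3

end IsNashFlow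

end GeneralizedNetwork

/-! ### Entropy and convergence of the rescaled labels -/

namespace GeneralizedNetwork

variable {V E : Type*} {G : GeneralizedNetwork V E}

open Classical in
/-- The transit time, set to zero on free arcs. -/
noncomputable def delay (G : GeneralizedNetwork V E) (e : E) : ℝ := if e ∈ G.free then 0 else G.τ e

theorem delay_nonneg (e : E) : 0 ≤ G.delay e := by
  unfold delay
  split_ifs
  · exact le_rfl
  · exact G.τ_nonneg e

/-- The ratio of the labels at the two ends of an arc, after the transit time. -/
noncomputable def labelRatio (G : GeneralizedNetwork V E) (l : V → ℝ) (e : E) : ℝ :=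
  l (G.tgt e) / (l (G.src e) + G.delay e)

theorem labelRatio_pos {l : V → ℝ} (h : ∀ v, 0 < l v) (e : E) : 0 < G.labelRatio l e :=
  div_pos (h _) (add_pos_of_pos_of_nonneg (h _) (delay_nonneg e))

open Classical in
/-- The contribution of an arc to the entropy of a labelling. -/
noncomputable def entropyTerm (G : GeneralizedNetwork V E) (l : V → ℝ) (e : E) : ℝ :=
  if e ∈ G.free then
    G.ν e * (l (G.tgt e) * (Real.log (l (G.tgt e)) - Real.log (l (G.src e))))
  else G.ν e * (l (G.tgt e) *
    max 0 (Real.log (l (G.tgt e)) - Real.log (l (G.src e) + G.τ e)))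

/-- A relative entropy of the labels along the arcs, which decreases along Nash flows. -/
noncomputable def entropy [Fintype E] (G : GeneralizedNetwork V E) (l : V → ℝ) : ℝ :=
  ∑ e, G.entropyTerm l e

variable [Fintype E]

open Classical in
-- On resetting arcs `ν_e ℓ_w' = x_e'`, which turns the product rule into exactly the summand of
-- `IsTight.sum_le_neg_dissipation`. Elsewhere the positive part is locally flat to first order.
theorem RegularAt.hasDerivAt_entropyTerm {x : E → ℝ → ℝ} {ℓ : V → ℝ → ℝ} {θ : ℝ}
    (hr : G.RegularAt x ℓ θ) (hpos : ∀ v, 0 < ℓ v θ) (e : E) :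
    HasDerivAt (fun t => G.entropyTerm (fun v => ℓ v t) e)
      (if e ∈ G.resetting (fun v => ℓ v θ) then
        G.ν e * (deriv (ℓ (G.tgt e)) θ -
          G.labelRatio (fun v => ℓ v θ) e * deriv (ℓ (G.src e)) θ) +
          deriv (x e) θ * Real.log (G.labelRatio (fun v => ℓ v θ) e) else 0) θ := by
  have hw := hpos (G.tgt e)
  have hv := hpos (G.src e)
  have hlw := (hr.label (G.tgt e)).log hw.ne'
  by_cases hf : e ∈ G.free
  · simp only [entropyTerm, if_pos hf]
    have hR : e ∈ G.resetting fun v => ℓ v θ := Or.inl hf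
    have hy := hr.tight.flow_eq e hR
    rw [if_pos hR, hy, labelRatio, delay, if_pos hf, add_zero, Real.log_div hw.ne' hv.ne']
    have hlv := (hr.label (G.src e)).log hv.ne'
    convert! ((hr.label (G.tgt e)).fun_mul (hlw.fun_sub hlv)).const_mul (G.ν e) using 1
    field_simp
    ring
  · simp only [entropyTerm, if_neg hf]
    have hv' : 0 < ℓ (G.src e) θ + G.τ e := add_pos_of_pos_of_nonneg hv (G.τ_nonneg e)
    have hlv := ((hr.label (G.src e)).add_const (G.τ e)).log hv'.ne'
    have hmax := _root_.hasDerivAt_max_zero (hlw.fun_sub hlv) fun h0 => by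
      have h1 : ℓ (G.tgt e) θ = ℓ (G.src e) θ + G.τ e :=
        Real.log_injOn_pos hw hv' (sub_eq_zero.1 h0)
      have h2 := hr.tight.label_eq e (Or.inr h1.ge) (by
        rintro (h | h)
        · exact hf h
        · exact absurd h1 h.ne')
      rw [h1, h2, sub_self]
    convert! ((hr.label (G.tgt e)).fun_mul hmax).const_mul (G.ν e) using 1
    by_cases hlt : ℓ (G.src e) θ + G.τ e < ℓ (G.tgt e) θ
    · have hR : e ∈ G.resetting fun v => ℓ v θ := Or.inr hlt
      have hlog := Real.log_lt_log hv' hlt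
      have hy := hr.tight.flow_eq e hR
      rw [if_pos hR, if_pos (sub_pos.2 hlog), max_eq_right (sub_pos.2 hlog).le, hy, labelRatio,
        delay, if_neg hf, Real.log_div hw.ne' hv'.ne']
      field_simp
      ring
    · have hR : e ∉ G.resetting fun v => ℓ v θ := by
        rintro (h | h)
        · exact hf h
        · exact hlt h
      have hlog := Real.log_le_log hw (not_lt.1 hlt)
      rw [if_neg hR, if_neg (by linarith), max_eq_left (by linarith)]
      simp

namespace IsNashFlow

theorem entropy_ac {x : E → ℝ → ℝ} {ℓ : V → ℝ → ℝ} (h : G.IsNashFlow x ℓ) {c a b : ℝ}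
    (hc : 0 < c) (ha : 0 ≤ a) (hab : a ≤ b) (hl : ∀ t ∈ Set.Icc a b, ∀ v, c ≤ ℓ v t) :
    AbsolutelyContinuousOnInterval (fun t => G.entropy fun v => ℓ v t) a b := by
  refine AbsolutelyContinuousOnInterval.sum fun e _ => ?_
  rw [← Set.uIcc_of_le hab] at hl
  have hw := h.label_ac_on (G.tgt e) ha hab
  have hv := h.label_ac_on (G.src e) ha hab
  unfold entropyTerm
  split_ifs
  · exact (hw.fun_mul ((hw.log hc fun t ht => hl t ht _).fun_sub
      (hv.log hc fun t ht => hl t ht _))).const_mul _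
  · refine (hw.fun_mul ((hw.log hc fun t ht => hl t ht _).fun_sub
      ((hv.fun_add (AbsolutelyContinuousOnInterval.const (G.τ e) a b)).log hc
        fun t ht => ?_)).max_zero).const_mul _
    linarith [hl t ht (G.src e), G.τ_nonneg e]

end IsNashFlow

variable [Fintype V]

theorem RegularAt.deriv_entropy_le {x : E → ℝ → ℝ} {ℓ : V → ℝ → ℝ} {θ : ℝ}
    (hr : G.RegularAt x ℓ θ) (hpos : ∀ v, 0 < ℓ v θ) :
    deriv (fun t => G.entropy fun v => ℓ v t) θ ≤
      -G.dissipation (G.resetting fun v => ℓ v θ) (G.labelRatio fun v => ℓ v θ)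
        (fun v => deriv (ℓ v) θ) := by
  classical
  have h1 := HasDerivAt.fun_sum (u := Finset.univ) fun e _ => hr.hasDerivAt_entropyTerm hpos e
  unfold entropy
  rw [h1.deriv, ← Finset.sum_filter]
  have := hr.tight.sum_le_neg_dissipation (k := G.labelRatio fun v => ℓ v θ)
    fun e _ => labelRatio_pos hpos e
  convert this

namespace IsNashFlow

variable {x : E → ℝ → ℝ} {ℓ : V → ℝ → ℝ}

theorem exists_abs_label_le (h : G.IsNashFlow x ℓ) :
    ∃ M : ℝ, 1 ≤ M ∧ (∀ θ, 1 ≤ θ → ∀ v, |ℓ v θ| ≤ M * θ) ∧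
      (∀ θ, 1 ≤ θ → ∀ e, |x e θ - x e 0| ≤ M * θ) ∧
      (∀ v a b, 0 ≤ a → a ≤ b → ℓ v b - ℓ v a ≤ M * (b - a)) := by
  obtain ⟨K, hK1, hK, hK'⟩ := G.exists_rate_bound
  have h1 : ∀ v, |ℓ v 0| ≤ ∑ v, |ℓ v 0| := fun v =>
    Finset.single_le_sum (f := fun v => |ℓ v 0|) (fun v _ => abs_nonneg _) (Finset.mem_univ v)
  have h0 : 0 ≤ ∑ v, |ℓ v 0| := Finset.sum_nonneg fun v _ => abs_nonneg _
  refine ⟨K + ∑ v, |ℓ v 0|, by linarith, fun θ hθ v => ?_, fun θ hθ e => ?_,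
    fun v a b ha hab => ?_⟩
  · have h2 := h.label_mono v le_rfl (by linarith : 0 ≤ θ)
    have h3 := h.label_sub_le hK v le_rfl (by linarith : 0 ≤ θ)
    have h4 := h1 v
    have h5 := abs_le.1 h4
    rw [abs_le]
    constructor <;> nlinarith
  · have h2 := h.flow_mono e le_rfl (by linarith : 0 ≤ θ)
    have h3 := h.flow_sub_le hK' e le_rfl (by linarith : 0 ≤ θ)
    rw [abs_of_nonneg (by linarith)]
    nlinarith
  · have h3 := h.label_sub_le hK v ha hab
    nlinarith

/-- Along a sequence of times tending to infinity, the rescaled labels subconverge to positive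
directions that are compatible with the active and resetting arcs. -/
theorem exists_scaled_limit (h : G.IsNashFlow x ℓ) {θ : ℕ → ℝ} (hθ : Tendsto θ atTop atTop)
    (h1 : ∀ n, 1 ≤ θ n) :
    ∃ (φ : ℕ → ℕ) (p : V → ℝ), StrictMono φ ∧
      (∀ v, Tendsto (fun n => ℓ v (θ (φ n)) / θ (φ n)) atTop (𝓝 (p v))) ∧
      p G.s = 1 ∧ (∀ v, 0 < p v) ∧ (∀ v, G.Reaches (G.coneActive p) G.s v) ∧
      (∀ᶠ n in atTop, G.active (fun v => ℓ v (θ (φ n))) ⊆ G.coneActive p) ∧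
      (∀ᶠ n in atTop, G.coneResetting p ⊆ G.resetting fun v => ℓ v (θ (φ n))) := by
  obtain ⟨M, hM1, hM, hM', -⟩ := h.exists_abs_label_le
  have hθ0 : ∀ n, 0 < θ n := fun n => by linarith [h1 n]
  obtain ⟨φ, p, hφ, hp⟩ := exists_subseq_tendsto_of_abs_le (fun n v => ℓ v (θ n) / θ n) M
    fun n v => by
      rw [abs_div, abs_of_pos (hθ0 n), div_le_iff₀ (hθ0 n)]
      exact hM _ (h1 n) v
  obtain ⟨ψ, X, hψ, hX⟩ := exists_subseq_tendsto_of_abs_le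
    (fun n e => (x e (θ (φ n)) - x e 0) / θ (φ n)) M fun n e => by
      rw [abs_div, abs_of_pos (hθ0 _), div_le_iff₀ (hθ0 _)]
      exact hM' _ (h1 _) e
  have hp : ∀ v, Tendsto (fun n => ℓ v (θ (φ (ψ n))) / θ (φ (ψ n))) atTop (𝓝 (p v)) :=
    fun v => (hp v).comp hψ.tendsto_atTop
  set t : ℕ → ℝ := fun n => θ (φ (ψ n)) with ht
  have ht0 : ∀ n, 0 < t n := fun n => hθ0 _
  have htt : Tendsto t atTop atTop :=
    hθ.comp (hφ.tendsto_atTop.comp hψ.tendsto_atTop)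
  have hconst : ∀ c : ℝ, Tendsto (fun n => c / t n) atTop (𝓝 0) := fun c =>
    tendsto_const_nhds.div_atTop htt
  have hps : p G.s = 1 := by
    refine tendsto_nhds_unique (hp G.s) ?_
    have h2 : Tendsto (fun n => ℓ G.s 0 / t n + 1) atTop (𝓝 (0 + 1)) :=
      (hconst _).add tendsto_const_nhds
    rw [zero_add] at h2
    refine h2.congr fun n => ?_
    have h3 := h.label_source_sub le_rfl (ht0 n).le
    have h4 : ℓ G.s (t n) = ℓ G.s 0 + t n := by linarith
    change _ = ℓ G.s (t n) / t n
    rw [h4, add_div, div_self (ht0 n).ne']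
  have hp0 : ∀ v, 0 ≤ p v := by
    intro v
    refine le_of_tendsto_of_tendsto' (hconst (ℓ v 0)) (hp v) fun n => ?_
    exact div_le_div_of_nonneg_right (h.label_mono v le_rfl (ht0 n).le) (ht0 n).le
  have hdiff : ∀ e, Tendsto (fun n => (ℓ (G.tgt e) (t n) - ℓ (G.src e) (t n) - G.τ e) / t n) atTop
      (𝓝 (p (G.tgt e) - p (G.src e))) := by
    intro e
    have h2 := ((hp (G.tgt e)).sub (hp (G.src e))).sub (hconst (G.τ e))
    rw [sub_zero] at h2
    refine h2.congr fun n => ?_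
    rw [sub_div, sub_div]
  have hact : ∀ᶠ n in atTop, G.active (fun v => ℓ v (t n)) ⊆ G.coneActive p := by
    have : ∀ᶠ n in atTop, ∀ e, e ∉ G.coneActive p → e ∉ G.active fun v => ℓ v (t n) := by
      refine eventually_all.2 fun e => ?_
      by_cases he : e ∈ G.coneActive p
      · exact Eventually.of_forall fun n h => absurd he h
      · simp only [coneActive, Set.mem_ofPred_eq, not_or, not_le] at he
        filter_upwards [(hdiff e).eventually_lt_const (sub_neg.2 he.2)] with n hn _
        rw [div_lt_iff₀ (ht0 n), zero_mul] at hn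
        rintro (h3 | h3)
        · exact he.1 h3
        · linarith
    filter_upwards [this] with n hn e he
    by_contra hc
    exact hn e hc he
  have hres : ∀ᶠ n in atTop, G.coneResetting p ⊆ G.resetting fun v => ℓ v (t n) := by
    refine eventually_all.2 fun e => ?_
    by_cases hf : e ∈ G.free
    · exact Eventually.of_forall fun n _ => Or.inl hf
    by_cases hlt : p (G.src e) < p (G.tgt e)
    · filter_upwards [(hdiff e).eventually_const_lt (sub_pos.2 hlt)] with n hn _
      rw [div_pos_iff_of_pos_right (ht0 n)] at hn
      exact Or.inr (by linarith)
    · exact Eventually.of_forall fun n h3 => absurd h3 (by rintro (h4 | h4); exacts [hf h4, hlt h4])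
  have hreach : ∀ v, G.Reaches (G.coneActive p) G.s v := by
    obtain ⟨n, hn⟩ := hact.exists
    exact fun v => (h.reaches (t n) (ht0 n).le v).mono hn
  have hcirc : G.IsCirculation X := by
    refine isCirculation_iff_excess.2 fun v => ?_
    have h2 := ((continuous_excess (G := G) v).tendsto X).comp (tendsto_pi_nhds.2 hX)
    refine tendsto_nhds_unique h2 (tendsto_const_nhds.congr fun n => ?_)
    have h3 := isCirculation_iff_excess.1 (h.isCirculation_sub le_rfl (ht0 n).le) v
    simp only [excess, Function.comp_apply, ← Finset.sum_div] at h3 ⊢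
    rw [← sub_div, h3, zero_div]
  have hXle : ∀ e, X e ≤ G.ν e * p (G.tgt e) := by
    intro e
    have h2 := ((hp (G.tgt e)).sub (hconst (ℓ (G.tgt e) 0))).const_mul (G.ν e)
    rw [sub_zero] at h2
    refine le_of_tendsto_of_tendsto' (hX e) h2 fun n => ?_
    rw [← sub_div, mul_div_assoc']
    exact div_le_div_of_nonneg_right (h.flow_sub_le_label_sub e le_rfl (ht0 n).le) (ht0 n).le
  -- This bound makes the limit flow positive on arcs leaving the zero set of `p`, as `label_pos`
  -- requires.
  have hXge : ∀ e, G.ν e * (p (G.tgt e) - p (G.src e)) ≤ X e := by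
    intro e
    by_cases hf : e ∈ G.free
    · have h2 := ((hp (G.tgt e)).sub (hconst (ℓ (G.tgt e) 0))).const_mul (G.ν e)
      rw [sub_zero] at h2
      have h3 : X e = G.ν e * p (G.tgt e) := tendsto_nhds_unique (hX e) (h2.congr fun n => by
        rw [← sub_div, mul_div_assoc', ← h.flow_sub_eq_of_free hf le_rfl (ht0 n).le])
      rw [h3]
      exact mul_le_mul_of_nonneg_left (by linarith [hp0 (G.src e)]) (G.ν_pos e).le
    · have h2 := ((hdiff e).sub (hconst (max 0 (ℓ (G.tgt e) 0 - ℓ (G.src e) 0 - G.τ e)))).const_mul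
        (G.ν e)
      rw [sub_zero] at h2
      refine le_of_tendsto_of_tendsto' h2 (hX e) fun n => ?_
      rw [← sub_div, mul_div_assoc']
      refine div_le_div_of_nonneg_right (le_trans ?_
        (h.queue_sub_le_flow_sub hf le_rfl (ht0 n).le)) (ht0 n).le
      exact mul_le_mul_of_nonneg_left (sub_le_sub_right (le_max_right _ _) _) (G.ν_pos e).le
  refine ⟨φ ∘ ψ, p, hφ.comp hψ, hp, hps, ?_, hreach, hact, hres⟩
  refine label_pos hcirc (fun e => ge_of_tendsto' (hX e) fun n => ?_) hp0 hXle (fun e h2 h3 => ?_)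
    (by rw [hps]; exact one_pos) hreach
  · exact div_nonneg (sub_nonneg.2 (h.flow_mono e le_rfl (ht0 n).le)) (ht0 n).le
  · refine lt_of_lt_of_le ?_ (hXge e)
    rw [h2, sub_zero]
    exact mul_pos (G.ν_pos e) h3

/-- Otherwise, along some sequence of times, a rescaled label falls below `1/(n+1)`, against the
positivity of subsequential limits. -/
theorem exists_mul_le_label (h : G.IsNashFlow x ℓ) :
    ∃ c Θ : ℝ, 0 < c ∧ 1 ≤ Θ ∧ ∀ θ, Θ ≤ θ → ∀ v, c * θ ≤ ℓ v θ := by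
  by_contra! hcon
  choose θ hθ v hv using fun n : ℕ => hcon ((n : ℝ) + 1)⁻¹ (n + 1) (by positivity)
    (by linarith [(Nat.cast_nonneg n : (0 : ℝ) ≤ n)])
  have h1 : ∀ n, 1 ≤ θ n := fun n => by linarith [hθ n, (Nat.cast_nonneg n : (0 : ℝ) ≤ n)]
  have htt : Tendsto θ atTop atTop := tendsto_atTop_mono hθ
    (tendsto_atTop_add_const_right _ _ tendsto_natCast_atTop_atTop)
  obtain ⟨φ, p, hφ, hp, -, hpos, -⟩ := h.exists_scaled_limit htt h1
  have hinv : Tendsto (fun n => ((φ n : ℝ) + 1)⁻¹) atTop (𝓝 0) :=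
    (tendsto_atTop_add_const_right _ (1 : ℝ)
      (tendsto_natCast_atTop_atTop.comp hφ.tendsto_atTop)).inv_tendsto_atTop
  have hev : ∀ᶠ n in atTop, ∀ w, ((φ n : ℝ) + 1)⁻¹ < ℓ w (θ (φ n)) / θ (φ n) :=
    eventually_all.2 fun w => hinv.eventually_lt (hp w) (hpos w)
  obtain ⟨n, hn⟩ := hev.exists
  have h2 := hn (v (φ n))
  rw [lt_div_iff₀ (by linarith [h1 (φ n)])] at h2
  exact lt_asymm h2 (hv (φ n))

/-- If the rescaled labels are not close to those of the cone flow, then dissipation is bounded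
away from zero. -/
theorem exists_le_dissipation (h : G.IsNashFlow x ℓ) {y : E → ℝ} {q : V → ℝ}
    (hq : G.IsConeFlow y q) {ε : ℝ} (hε : 0 < ε) :
    ∃ δ Θ : ℝ, 0 < δ ∧ ∀ θ, Θ ≤ θ → G.RegularAt x ℓ θ → (∃ v, ε ≤ |ℓ v θ / θ - q v|) →
      δ ≤ G.dissipation (G.resetting fun v => ℓ v θ) (G.labelRatio fun v => ℓ v θ)
        (fun v => deriv (ℓ v) θ) := by
  by_contra! hcon
  choose θ hθ hreg hv hD using fun n : ℕ => hcon ((n : ℝ) + 1)⁻¹ (n + 1) (by positivity)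
  have h1 : ∀ n, 1 ≤ θ n := fun n => by linarith [hθ n, (Nat.cast_nonneg n : (0 : ℝ) ≤ n)]
  have htt : Tendsto θ atTop atTop := tendsto_atTop_mono hθ
    (tendsto_atTop_add_const_right _ _ tendsto_natCast_atTop_atTop)
  obtain ⟨φ, p, hφ, hp, hps, hpos, hreach, hact, hres⟩ := h.exists_scaled_limit htt h1
  obtain ⟨K, hK1, hK, hK'⟩ := G.exists_rate_bound
  obtain ⟨ψ, lam, hψ, hlam⟩ := exists_subseq_tendsto_of_abs_le
    (fun n v => deriv (ℓ v) (θ (φ n))) K fun n v => by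
      rw [abs_of_nonneg ((hreg _).tight.label_nonneg v)]
      exact hK _ _ _ _ (hreg _).tight v
  obtain ⟨χ, Y, hχ, hY⟩ := exists_subseq_tendsto_of_abs_le
    (fun n e => deriv (x e) (θ (φ (ψ n)))) K fun n e => by
      rw [abs_of_nonneg ((hreg _).tight.flow_nonneg e)]
      exact hK' _ _ _ _ (hreg _).tight e
  set m : ℕ → ℕ := fun n => φ (ψ (χ n)) with hm
  have hψχ : Tendsto (fun n => ψ (χ n)) atTop atTop := hψ.tendsto_atTop.comp hχ.tendsto_atTop
  have hmt : Tendsto m atTop atTop := hφ.tendsto_atTop.comp hψχ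
  have hp : ∀ v, Tendsto (fun n => ℓ v (θ (m n)) / θ (m n)) atTop (𝓝 (p v)) :=
    fun v => (hp v).comp hψχ
  have hlam : ∀ v, Tendsto (fun n => deriv (ℓ v) (θ (m n))) atTop (𝓝 (lam v)) :=
    fun v => (hlam v).comp hχ.tendsto_atTop
  have hY : ∀ e, Tendsto (fun n => deriv (x e) (θ (m n))) atTop (𝓝 (Y e)) := hY
  have hact : ∀ᶠ n in atTop, G.active (fun v => ℓ v (θ (m n))) ⊆ G.coneActive p :=
    hψχ.eventually hact
  have hres : ∀ᶠ n in atTop, G.coneResetting p ⊆ G.resetting fun v => ℓ v (θ (m n)) :=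
    hψχ.eventually hres
  have htt : Tendsto (fun n => θ (m n)) atTop atTop := htt.comp hmt
  have hθ0 : ∀ n, 0 < θ n := fun n => by linarith [h1 n]
  have hlpos : ∀ᶠ n in atTop, ∀ v, 0 < ℓ v (θ (m n)) := by
    refine eventually_all.2 fun v => ?_
    filter_upwards [(hp v).eventually_const_lt (hpos v)] with n hn
    rwa [div_pos_iff_of_pos_right (hθ0 _)] at hn
  have hinv : Tendsto (fun n => ((m n : ℝ) + 1)⁻¹) atTop (𝓝 0) :=
    (tendsto_atTop_add_const_right _ (1 : ℝ)
      (tendsto_natCast_atTop_atTop.comp hmt)).inv_tendsto_atTop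
  have hratio : ∀ e, Tendsto (fun n => G.labelRatio (fun v => ℓ v (θ (m n))) e) atTop
      (𝓝 (p (G.tgt e) / p (G.src e))) := by
    intro e
    have h2 : Tendsto (fun n => ℓ (G.src e) (θ (m n)) / θ (m n) + G.delay e / θ (m n)) atTop
        (𝓝 (p (G.src e) + 0)) := (hp _).add (tendsto_const_nhds.div_atTop htt)
    rw [add_zero] at h2
    refine ((hp (G.tgt e)).div h2 (hpos _).ne').congr fun n => ?_
    rw [Pi.div_apply, ← add_div, div_div_div_cancel_right₀ (hθ0 _).ne', labelRatio]
  have hlam0 : ∀ v, 0 ≤ lam v := fun v => ge_of_tendsto' (hlam v) fun n =>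
    (hreg _).tight.label_nonneg v
  -- Equality of limiting rates and directions propagates from the source: an arc active infinitely
  -- often has vanishing dissipation, so `lam_w = (p_w / p_v) lam_v`.
  have hlamp : ∀ v, lam v = p v := by
    by_contra! hne
    obtain ⟨u, hu⟩ := hne
    set T : Set V := {v | lam v ≠ p v} with hT
    have hlams : lam G.s = 1 := tendsto_nhds_unique (hlam G.s)
      (tendsto_const_nhds.congr fun n => ((hreg _).tight.label_source).symm)
    have hsT : G.s ∉ T := by simp [hT, hlams, hps]
    have hfreq : ∃ e, G.src e ∉ T ∧ G.tgt e ∈ T ∧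
        ∃ᶠ n in atTop, e ∈ G.active fun v => ℓ v (θ (m n)) := by
      by_contra! hcon
      have : ∀ᶠ n in atTop, ∀ e, G.src e ∉ T → G.tgt e ∈ T →
          e ∉ G.active fun v => ℓ v (θ (m n)) := by
        refine eventually_all.2 fun e => ?_
        by_cases h2 : G.src e ∉ T ∧ G.tgt e ∈ T
        · exact (hcon e h2.1 h2.2).mono fun n hn _ _ => hn
        · exact Eventually.of_forall fun n h3 h4 => absurd ⟨h3, h4⟩ h2
      obtain ⟨n, hn⟩ := this.exists
      obtain ⟨e, he, h2, h3⟩ := ((hreg (m n)).tight.reaches u).exists_entering hsT hu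
      exact hn e h2 h3 he
    obtain ⟨e, h2, h3, hfr⟩ := hfreq
    have hlim : Tendsto (fun n => G.ν e * (√(deriv (ℓ (G.tgt e)) (θ (m n))) -
        √(G.labelRatio (fun v => ℓ v (θ (m n))) e * deriv (ℓ (G.src e)) (θ (m n)))) ^ 2) atTop
        (𝓝 (G.ν e * (√(lam (G.tgt e)) - √(p (G.tgt e) / p (G.src e) * lam (G.src e))) ^ 2)) :=
      (((hlam _).sqrt.sub ((hratio e).mul (hlam _)).sqrt).pow 2).const_mul _
    have hle : G.ν e * (√(lam (G.tgt e)) - √(p (G.tgt e) / p (G.src e) * lam (G.src e))) ^ 2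
        ≤ 0 := by
      refine le_of_tendsto_of_tendsto_of_frequently hlim hinv ((hfr.and_eventually hlpos).mono ?_)
      rintro n ⟨hA, hl⟩
      refine le_trans ?_ (hD (m n)).le
      by_cases hR : e ∈ G.resetting fun v => ℓ v (θ (m n))
      · exact le_dissipation (G := G) (G.labelRatio fun v => ℓ v (θ (m n)))
          (fun v => deriv (ℓ v) (θ (m n))) hR
      -- A non-resetting active arc is absent from the dissipation, but its ratio is `1` and its
      -- label rates agree, so the expression is zero anyway.
      · refine le_trans (le_of_eq ?_) (dissipation_nonneg _ _ _)
        have h4 := (hreg (m n)).tight.label_eq e hA hR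
        simp only [resetting, Set.mem_ofPred_eq, not_or, not_lt] at hR
        have h5 : G.labelRatio (fun v => ℓ v (θ (m n))) e = 1 := by
          have h6 := le_antisymm hR.2 (hA.resolve_left hR.1)
          rw [labelRatio, delay, if_neg hR.1, ← h6, div_self (hl _).ne']
        rw [h4, h5, one_mul, sub_self]
        simp
    have hsq : √(lam (G.tgt e)) = √(p (G.tgt e) / p (G.src e) * lam (G.src e)) := by
      have h4 := nonpos_of_mul_nonpos_right hle (G.ν_pos e)
      exact sub_eq_zero.1 (pow_eq_zero_iff two_ne_zero |>.1 (le_antisymm h4 (sq_nonneg _)))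
    have h5 : lam (G.src e) = p (G.src e) := by simpa [hT] using h2
    rw [h5, div_mul_cancel₀ _ (hpos _).ne', Real.sqrt_inj (hlam0 _) (hpos _).le] at hsq
    exact h3 hsq
  -- The limiting rates reproduce the directions `p`; uniqueness of cone labels then gives `p = q`,
  -- contrary to the deviation.
  have hcone : G.IsConeFlow Y p := by
    refine ⟨fun e he => Or.inl he, fun e he => he.imp id le_of_lt, hreach, ?_,
      fun e => ge_of_tendsto' (hY e) fun n => (hreg _).tight.flow_nonneg e, fun v => (hpos v).le,
      hps, fun e he => ?_, fun e he => ?_, fun e => ?_, fun e hA hR => ?_⟩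
    · refine isCirculation_iff_excess.2 fun v => ?_
      have h2 := ((continuous_excess (G := G) v).tendsto Y).comp (tendsto_pi_nhds.2 hY)
      refine tendsto_nhds_unique h2 (tendsto_const_nhds.congr fun n => ?_)
      exact (isCirculation_iff_excess.1 (hreg _).tight.circulation v).symm
    · refine tendsto_nhds_unique (hY e) (tendsto_const_nhds.congr' ?_)
      filter_upwards [hact] with n hn
      exact ((hreg _).tight.flow_eq_zero e fun hA => he (hn hA)).symm
    · rw [← hlamp]
      refine tendsto_nhds_unique (hY e) (((hlam _).const_mul _).congr' ?_)
      filter_upwards [hres] with n hn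
      exact ((hreg _).tight.flow_eq e (hn he)).symm
    · rw [← hlamp]
      exact le_of_tendsto_of_tendsto' (hY e) ((hlam _).const_mul _) fun n =>
        (hreg _).tight.flow_le e
    · simp only [coneResetting, Set.mem_ofPred_eq, not_or, not_lt] at hR
      exact le_antisymm hR.2 (hA.resolve_left hR.1)
  have hpq : p = q := hcone.label_unique hq
  have hev : ∀ᶠ n in atTop, ∀ v, |ℓ v (θ (m n)) / θ (m n) - q v| < ε := by
    refine eventually_all.2 fun v => ?_
    rw [← hpq]
    have := (hp v).sub_const (p v)
    rw [sub_self] at this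
    simpa using this.abs.eventually_lt_const (by simpa using hε)
  obtain ⟨n, hn⟩ := hev.exists
  obtain ⟨v, hv⟩ := hv (m n)
  exact absurd hv (not_le.2 (hn v))

/-- Subtract the pairing of the circulation `x(θ) - x(0)` with the logarithms of the labels, which
is zero. Each arc is then bounded below: the logarithmic ratios are bounded, the initial labels cost
a constant, and the transit time shifts a logarithm by at most `τ / (c θ)` against a flow of at most
`M θ`. -/
theorem exists_entropy_ge (h : G.IsNashFlow x ℓ) {c Θ : ℝ} (hc : 0 < c) (hΘ : 1 ≤ Θ)
    (hl : ∀ θ, Θ ≤ θ → ∀ v, c * θ ≤ ℓ v θ) :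
    ∃ C : ℝ, ∀ θ, Θ ≤ θ → -C ≤ G.entropy fun v => ℓ v θ := by
  obtain ⟨M, hM1, hM, hM', -⟩ := h.exists_abs_label_le
  set L := |Real.log (M / c)| with hL
  refine ⟨∑ e, (G.ν e * |ℓ (G.tgt e) 0| * L + M * G.τ e / c), fun θ hθ => ?_⟩
  have hθ1 : 1 ≤ θ := hΘ.trans hθ
  have hθ0 : 0 < θ := by linarith
  have hpos : ∀ v, 0 < ℓ v θ := fun v => lt_of_lt_of_le (mul_pos hc hθ0) (hl θ hθ v)
  have hlog : ∀ v w, |Real.log (ℓ w θ) - Real.log (ℓ v θ)| ≤ L := by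
    have h1 : ∀ v w, Real.log (ℓ w θ) - Real.log (ℓ v θ) ≤ L := by
      intro v w
      rw [← Real.log_div (hpos w).ne' (hpos v).ne']
      refine (Real.log_le_log (div_pos (hpos w) (hpos v)) ?_).trans (le_abs_self _)
      have h2 := (abs_le.1 (hM θ hθ1 w)).2
      have h3 := hl θ hθ v
      rw [div_le_div_iff₀ (hpos v) hc]
      nlinarith
    exact fun v w => abs_le.2 ⟨by linarith [h1 w v], h1 v w⟩
  have hcirc := (h.isCirculation_sub le_rfl hθ0.le).sum_mul_sub fun v => Real.log (ℓ v θ)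
  have hsum : (G.entropy fun v => ℓ v θ) = ∑ e, (G.entropyTerm (fun v => ℓ v θ) e -
      (x e θ - x e 0) * (Real.log (ℓ (G.tgt e) θ) - Real.log (ℓ (G.src e) θ))) := by
    rw [Finset.sum_sub_distrib, hcirc, sub_zero, entropy]
  rw [hsum, ← Finset.sum_neg_distrib]
  refine Finset.sum_le_sum fun e _ => ?_
  have hν := G.ν_pos e
  have hτ := G.τ_nonneg e
  have hL0 : 0 ≤ L := abs_nonneg _
  have hw := hpos (G.tgt e)
  have hv := hpos (G.src e)
  have hlog' := hlog (G.src e) (G.tgt e)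
  have hτc : 0 ≤ M * G.τ e / c := by positivity
  have habs := abs_nonneg (ℓ (G.tgt e) 0)
  unfold entropyTerm
  split_ifs with hf
  · rw [h.flow_sub_eq_of_free hf le_rfl hθ0.le]
    have h1 : |ℓ (G.tgt e) 0 * (Real.log (ℓ (G.tgt e) θ) - Real.log (ℓ (G.src e) θ))| ≤
        |ℓ (G.tgt e) 0| * L := by
      rw [abs_mul]
      exact mul_le_mul_of_nonneg_left hlog' habs
    have h2 := (abs_le.1 h1).1
    have h3 := mul_le_mul_of_nonneg_left h2 hν.le
    nlinarith
  · set X := x e θ - x e 0 with hX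
    have hX0 : 0 ≤ X := sub_nonneg.2 (h.flow_mono e le_rfl hθ0.le)
    have hX1 : X ≤ G.ν e * (ℓ (G.tgt e) θ - ℓ (G.tgt e) 0) :=
      h.flow_sub_le_label_sub e le_rfl hθ0.le
    have hX2 : X ≤ M * θ := (le_abs_self _).trans (hM' θ hθ1 e)
    have hv' : 0 < ℓ (G.src e) θ + G.τ e := by linarith
    set D := Real.log (ℓ (G.tgt e) θ) - Real.log (ℓ (G.src e) θ + G.τ e) with hD
    have hmono : Real.log (ℓ (G.src e) θ) ≤ Real.log (ℓ (G.src e) θ + G.τ e) :=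
      Real.log_le_log hv (by linarith)
    have hm0 : 0 ≤ max 0 D := le_max_left _ _
    have hmL : max 0 D ≤ L := max_le hL0 (by linarith [(abs_le.1 hlog').2])
    have hmD : D ≤ max 0 D := le_max_right _ _
    have hlogτ : Real.log (ℓ (G.src e) θ + G.τ e) - Real.log (ℓ (G.src e) θ) ≤ G.τ e / (c * θ) := by
      rw [← Real.log_div hv'.ne' hv.ne']
      refine (Real.log_le_sub_one_of_pos (div_pos hv' hv)).trans ?_
      rw [add_div, div_self hv.ne', add_sub_cancel_left]
      exact div_le_div_of_nonneg_left hτ (mul_pos hc hθ0) (hl θ hθ _)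
    have h1 : X * (Real.log (ℓ (G.src e) θ + G.τ e) - Real.log (ℓ (G.src e) θ)) ≤
        M * G.τ e / c := by
      refine (mul_le_mul hX2 hlogτ (by linarith) (by positivity)).trans (le_of_eq ?_)
      field_simp
    have h2 : (X + G.ν e * ℓ (G.tgt e) 0) * max 0 D ≤ G.ν e * (ℓ (G.tgt e) θ * max 0 D) := by
      rw [← mul_assoc]
      exact mul_le_mul_of_nonneg_right (by linarith) hm0
    have h3 : -(|ℓ (G.tgt e) 0| * L) ≤ ℓ (G.tgt e) 0 * max 0 D := by
      have h4 : |ℓ (G.tgt e) 0 * max 0 D| ≤ |ℓ (G.tgt e) 0| * L := by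
        rw [abs_mul, abs_of_nonneg hm0]
        exact mul_le_mul_of_nonneg_left hmL habs
      exact (abs_le.1 h4).1
    have h5 := mul_le_mul_of_nonneg_left h3 hν.le
    have h6 := mul_le_mul_of_nonneg_left hmD hX0
    nlinarith

/-- `ℓ(θ)/θ` varies slowly on a logarithmic time scale, so a deviation `ε` at `θ` leaves at least
`ε/2` on `[θ, (1 + η) θ]`. The entropy would drop there by `δ η θ`, more than its total budget `W₀ +
C` once `θ` is large. -/
theorem abs_label_div_sub_lt (h : G.IsNashFlow x ℓ) {y : E → ℝ} {q : V → ℝ}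
    (hq : G.IsConeFlow y q) {ε : ℝ} (hε : 0 < ε) :
    ∃ Θ : ℝ, 1 ≤ Θ ∧ ∀ θ, Θ ≤ θ → ∀ v, |ℓ v θ / θ - q v| < ε := by
  obtain ⟨c, Θ₀, hc, hΘ₀, hl⟩ := h.exists_mul_le_label
  obtain ⟨C, hC⟩ := h.exists_entropy_ge hc hΘ₀ hl
  obtain ⟨δ, Θ₁, hδ, hD⟩ := h.exists_le_dissipation hq (half_pos hε)
  obtain ⟨M, hM1, hM, -, hM''⟩ := h.exists_abs_label_le
  -- On this interval the rescaled label moves by at most `2 M η = ε / 2`.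
  set η := ε / (4 * M) with hη
  have hη0 : 0 < η := by positivity
  have hdecr : ∀ d a b, Θ₀ ≤ a → a ≤ b → (∀ t ∈ Set.Icc a b, G.RegularAt x ℓ t →
      d ≤ G.dissipation (G.resetting fun v => ℓ v t) (G.labelRatio fun v => ℓ v t)
        (fun v => deriv (ℓ v) t)) →
      (G.entropy fun v => ℓ v b) - (G.entropy fun v => ℓ v a) ≤ -d * (b - a) := by
    intro d a b ha hab hd
    have hpos : ∀ t ∈ Set.Icc a b, ∀ v, c ≤ ℓ v t := fun t ht v =>
      (le_mul_of_one_le_right hc.le (by linarith [ht.1])).trans (hl t (ha.trans ht.1) v)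
    refine (h.entropy_ac hc (by linarith) hab hpos).sub_le_mul hab
      (h.ae_regular_Icc (by linarith) fun t ht hr => ?_)
    exact (hr.deriv_entropy_le fun v => hc.trans_le (hpos t ht v)).trans (neg_le_neg (hd t ht hr))
  set W₀ := G.entropy fun v => ℓ v Θ₀ with hW₀
  set Θ := max Θ₀ (max Θ₁ ((W₀ + C) / (δ * η) + 1)) with hΘ
  refine ⟨Θ, hΘ₀.trans (le_max_left _ _), fun θ hθ v => ?_⟩
  have hθΘ₀ : Θ₀ ≤ θ := (le_max_left _ _).trans hθ
  have hθΘ₁ : Θ₁ ≤ θ := (le_max_left _ _).trans ((le_max_right _ _).trans hθ)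
  have hθ2 : (W₀ + C) / (δ * η) + 1 ≤ θ := (le_max_right _ _).trans ((le_max_right _ _).trans hθ)
  have hθ0 : 0 < θ := by linarith
  by_contra! hbad
  have h1 := hdecr 0 Θ₀ θ le_rfl hθΘ₀ fun t _ _ => dissipation_nonneg _ _ _
  have hle : θ ≤ (1 + η) * θ := by nlinarith
  have h2 := hdecr δ θ ((1 + η) * θ) hθΘ₀ hle fun t ht hr => by
    refine hD t (hθΘ₁.trans ht.1) hr ⟨v, ?_⟩
    have ht0 : 0 < t := hθ0.trans_le ht.1
    have h3 : |ℓ v t / t - ℓ v θ / θ| ≤ ε / 2 := by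
      have h4 := h.label_mono v hθ0.le ht.1
      have h5 := hM'' v θ t hθ0.le ht.1
      have h6 := abs_le.1 (hM θ (by linarith) v)
      have h7 : ℓ v t / t - ℓ v θ / θ = ((ℓ v t - ℓ v θ) * θ - ℓ v θ * (t - θ)) / (t * θ) := by
        field_simp
        ring
      have htθ : 0 ≤ t - θ := sub_nonneg.2 ht.1
      have h8 : |(ℓ v t - ℓ v θ) * θ - ℓ v θ * (t - θ)| ≤ 2 * M * (t - θ) * θ := by
        rw [abs_le]
        have h9 := mul_le_mul_of_nonneg_right h5 hθ0.le
        have h10 := mul_le_mul_of_nonneg_right h6.1 htθ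
        have h11 := mul_le_mul_of_nonneg_right h6.2 htθ
        have h12 := mul_nonneg (sub_nonneg.2 h4) hθ0.le
        have h13 : 0 ≤ M * (t - θ) * θ := by positivity
        constructor <;> nlinarith
      rw [h7, abs_div, abs_of_pos (mul_pos ht0 hθ0), div_le_iff₀ (mul_pos ht0 hθ0)]
      refine h8.trans ?_
      have h14 : t - θ ≤ η * θ := by linarith [ht.2]
      have h15 : 2 * M * (t - θ) ≤ ε / 2 * t := by
        have h16 : 2 * M * (t - θ) ≤ 2 * M * (η * θ) :=
          mul_le_mul_of_nonneg_left h14 (by linarith)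
        have h17 : 2 * M * (η * θ) = ε / 2 * θ := by
          rw [hη]
          field_simp
          ring
        have h18 := mul_le_mul_of_nonneg_left ht.1 (half_pos hε).le
        linarith
      have h19 := mul_le_mul_of_nonneg_right h15 hθ0.le
      linarith
    have h4 := abs_sub_le (ℓ v θ / θ) (ℓ v t / t) (q v)
    rw [abs_sub_comm (ℓ v θ / θ) (ℓ v t / t)] at h4
    linarith
  have h3 := hC ((1 + η) * θ) (hθΘ₀.trans hle)
  have h4 : W₀ + C < δ * η * θ := by
    have h5 : (W₀ + C) / (δ * η) < θ := by linarith
    rwa [div_lt_iff₀' (mul_pos hδ hη0)] at h5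
  nlinarith

theorem tendsto_label_div (h : G.IsNashFlow x ℓ) {y : E → ℝ} {q : V → ℝ}
    (hq : G.IsConeFlow y q) (v : V) : Tendsto (fun θ => ℓ v θ / θ) atTop (𝓝 (q v)) := by
  refine Metric.tendsto_atTop.2 fun ε hε => ?_
  obtain ⟨Θ, -, hΘ⟩ := h.abs_label_div_sub_lt hq hε
  exact ⟨Θ, fun θ hθ => hΘ θ hθ v⟩

end IsNashFlow

end GeneralizedNetwork

/-! ### The cone potential and finite-time steady state -/

namespace GeneralizedNetwork

variable {V E : Type*} {G : GeneralizedNetwork V E}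

theorem label_eq_of_mem_coneActive {q : V → ℝ} {e : E} (hA : e ∈ G.coneActive q)
    (hR : e ∉ G.coneResetting q) : q (G.tgt e) = q (G.src e) := by
  simp only [coneResetting, Set.mem_ofPred_eq, not_or, not_lt] at hR
  exact le_antisymm hR.2 (hA.resolve_left hR.1)

open Classical in
/-- The contribution of an arc to the potential `conePotential`. -/
noncomputable def coneTerm (G : GeneralizedNetwork V E) (q l : V → ℝ) (e : E) : ℝ :=
  if e ∈ G.coneResetting q then
    G.ν e * (l (G.tgt e) - q (G.tgt e) / q (G.src e) * l (G.src e))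
  else if e ∈ G.coneActive q then G.ν e * max 0 (l (G.tgt e) - l (G.src e) - G.τ e)
  else 0

/-- A weighted total queue length, adapted to the asymptotic directions `q`. -/
noncomputable def conePotential [Fintype E] (G : GeneralizedNetwork V E) (q l : V → ℝ) : ℝ :=
  ∑ e, G.coneTerm q l e

open Classical in
/-- Total weighted transit time of the flow `z` along arcs whose ends have equal directions. -/
noncomputable def coneCost [Fintype E] (G : GeneralizedNetwork V E) (q : V → ℝ) (z : E → ℝ) : ℝ :=
  ∑ e, if e ∈ G.coneResetting q then 0 else z e / q (G.tgt e) * G.τ e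

variable [Fintype E]

open Classical in
-- Weak duality, arc by arc: on balanced arcs `0 ≤ z_e / q_w ≤ ν_e`, so the linear queue term is at
-- most `ν_e` times its positive part.
theorem IsConeFlow.le_coneTerm {z : E → ℝ} {q : V → ℝ} (hz : G.IsConeFlow z q) (l : V → ℝ)
    (e : E) :
    z e * (l (G.tgt e) / q (G.tgt e) - l (G.src e) / q (G.src e)) -
      (if e ∈ G.coneResetting q then 0 else z e / q (G.tgt e) * G.τ e) ≤ G.coneTerm q l e := by
  have hw := hz.pos (G.tgt e)
  have hv := hz.pos (G.src e)
  unfold coneTerm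
  split_ifs with hR hA
  · rw [hz.flow_eq e hR]
    refine le_of_eq ?_
    field_simp
    ring
  · rw [← label_eq_of_mem_coneActive hA hR]
    have h1 : z e / q (G.tgt e) ≤ G.ν e := (div_le_iff₀ hw).2 (hz.flow_le e)
    have h2 : 0 ≤ z e / q (G.tgt e) := div_nonneg (hz.flow_nonneg e) hw.le
    have h3 : z e * (l (G.tgt e) / q (G.tgt e) - l (G.src e) / q (G.tgt e)) -
        z e / q (G.tgt e) * G.τ e =
        z e / q (G.tgt e) * (l (G.tgt e) - l (G.src e) - G.τ e) := by ring
    rw [h3]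
    exact (mul_le_mul_of_nonneg_left (le_max_right _ _) h2).trans
      (mul_le_mul_of_nonneg_right h1 (le_max_left _ _))
  · rw [hz.flow_eq_zero e hA]
    simp

open Classical in
-- Complementary slackness: the weak-duality bound is sharp if queued arcs are saturated and
-- inactive arcs are empty.
theorem IsConeFlow.coneTerm_eq {z : E → ℝ} {q : V → ℝ} (hz : G.IsConeFlow z q) {l : V → ℝ}
    {e : E} (h1 : e ∈ G.resetting l → z e = G.ν e * q (G.tgt e)) (h2 : e ∉ G.active l → z e = 0) :
    z e * (l (G.tgt e) / q (G.tgt e) - l (G.src e) / q (G.src e)) -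
      (if e ∈ G.coneResetting q then 0 else z e / q (G.tgt e) * G.τ e) = G.coneTerm q l e := by
  have hw := hz.pos (G.tgt e)
  have hv := hz.pos (G.src e)
  unfold coneTerm
  split_ifs with hR hA
  · rw [hz.flow_eq e hR]
    field_simp
    ring
  · rw [← label_eq_of_mem_coneActive hA hR]
    rcases lt_trichotomy (l (G.src e) + G.τ e) (l (G.tgt e)) with hlt | heq | hgt
    · rw [h1 (Or.inr hlt), max_eq_right (by linarith)]
      field_simp
    · rw [max_eq_left (by linarith), ← heq]
      ring
    · rw [h2 (by rintro (h | h); exacts [hR (Or.inl h), not_lt.2 h hgt]), max_eq_left (by linarith)]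
      simp
  · rw [hz.flow_eq_zero e hA]
    simp

theorem IsNashFlow.conePotential_ac {x : E → ℝ → ℝ} {ℓ : V → ℝ → ℝ}
    (h : G.IsNashFlow x ℓ) (q : V → ℝ) {a b : ℝ} (ha : 0 ≤ a) (hab : a ≤ b) :
    AbsolutelyContinuousOnInterval (fun t => G.conePotential q fun v => ℓ v t) a b := by
  refine AbsolutelyContinuousOnInterval.sum fun e _ => ?_
  have hw := h.label_ac_on (G.tgt e) ha hab
  have hv := h.label_ac_on (G.src e) ha hab
  unfold coneTerm
  split_ifs
  · exact (hw.fun_sub (hv.const_mul _)).const_mul _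
  · exact ((hw.fun_sub hv).fun_sub
      (AbsolutelyContinuousOnInterval.const (G.τ e) a b)).max_zero.const_mul _
  · exact AbsolutelyContinuousOnInterval.const 0 a b

variable [Fintype V]

theorem IsConeFlow.sum_coneTerm {z : E → ℝ} {q : V → ℝ} (hz : G.IsConeFlow z q) (l : V → ℝ) :
    ∑ e, (z e * (l (G.tgt e) / q (G.tgt e) - l (G.src e) / q (G.src e)) -
      (open Classical in if e ∈ G.coneResetting q then 0 else z e / q (G.tgt e) * G.τ e)) =
      -G.coneCost q z := by
  rw [Finset.sum_sub_distrib, hz.circulation.sum_mul_sub fun v => l v / q v, zero_sub, coneCost]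

theorem IsConeFlow.neg_coneCost_le {z : E → ℝ} {q : V → ℝ} (hz : G.IsConeFlow z q) (l : V → ℝ) :
    -G.coneCost q z ≤ G.conePotential q l := by
  rw [← hz.sum_coneTerm l]
  exact Finset.sum_le_sum fun e _ => hz.le_coneTerm l e

theorem IsConeFlow.conePotential_eq {z : E → ℝ} {q : V → ℝ} (hz : G.IsConeFlow z q) {l : V → ℝ}
    (h1 : ∀ e ∈ G.resetting l, z e = G.ν e * q (G.tgt e)) (h2 : ∀ e, e ∉ G.active l → z e = 0) :
    G.conePotential q l = -G.coneCost q z := by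
  rw [← hz.sum_coneTerm l]
  exact Finset.sum_congr rfl fun e _ => (hz.coneTerm_eq (h1 e) (h2 e)).symm

theorem IsTight.eq_of_dissipation_nonpos {A R : Set E} {y z : E → ℝ} {lam q : V → ℝ}
    (h : G.IsTight A R y lam) (hq : G.IsConeFlow z q) (hA : A ⊆ G.coneActive q)
    (hR : G.coneResetting q ⊆ R)
    (hd : G.dissipation R (fun e => q (G.tgt e) / q (G.src e)) lam ≤ 0) : lam = q := by
  by_contra hne
  obtain ⟨v, hv⟩ := Function.ne_iff.1 hne
  obtain ⟨e, he, h1, h2⟩ := (h.reaches v).exists_entering (T := {v | lam v ≠ q v})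
    (by simp [h.label_source, hq.label_source]) hv
  have h1 : lam (G.src e) = q (G.src e) := by simpa using h1
  refine h2 ?_
  by_cases heR : e ∈ R
  · have h3 := (le_dissipation (G := G) (fun e => q (G.tgt e) / q (G.src e)) lam heR).trans hd
    have h4 := nonpos_of_mul_nonpos_right h3 (G.ν_pos e)
    have h5 := sub_eq_zero.1 (pow_eq_zero_iff two_ne_zero |>.1 (le_antisymm h4 (sq_nonneg _)))
    rwa [h1, div_mul_cancel₀ _ (hq.pos _).ne',
      Real.sqrt_inj (h.label_nonneg _) (hq.pos _).le] at h5
  · rw [h.label_eq e he heR, h1, label_eq_of_mem_coneActive (hA he) fun hc => heR (hR hc)]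

/-- Only finitely many pairs `(R, lam)` occur, and zero dissipation would force `lam = q`. -/
theorem IsConeFlow.exists_dissipation_gap {z : E → ℝ} {q : V → ℝ} (hq : G.IsConeFlow z q) :
    ∃ c > 0, ∀ A R y lam, G.IsTight A R y lam → A ⊆ G.coneActive q → G.coneResetting q ⊆ R →
      lam ≠ q → c ≤ G.dissipation R (fun e => q (G.tgt e) / q (G.src e)) lam := by
  set S : Set (Set E × (V → ℝ)) := {c | ∃ A y, G.IsTight A c.1 y c.2 ∧ A ⊆ G.coneActive q ∧
    G.coneResetting q ⊆ c.1 ∧ c.2 ≠ q} with hS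
  have hfin : S.Finite := by
    refine (Set.finite_univ.prod G.finite_tight_labels).subset ?_
    rintro ⟨R, lam⟩ ⟨A, y, h, -⟩
    exact ⟨Set.mem_univ _, A, R, y, h⟩
  set d : Set E × (V → ℝ) → ℝ :=
    fun c => G.dissipation c.1 (fun e => q (G.tgt e) / q (G.src e)) c.2 with hd
  rcases S.eq_empty_or_nonempty with hemp | hne
  · refine ⟨1, one_pos, fun A R y lam h hA hR hne => ?_⟩
    have : (R, lam) ∈ S := ⟨A, y, h, hA, hR, hne⟩
    rw [hemp] at this
    exact absurd this (Set.notMem_empty _)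
  · obtain ⟨c, ⟨A, y, h, hA, hR, hcq⟩, hmin⟩ := Set.exists_min_image S d hfin hne
    refine ⟨d c, ?_, fun A R y lam h hA hR hne => hmin (R, lam) ⟨A, y, h, hA, hR, hne⟩⟩
    by_contra hc
    exact hcq (h.eq_of_dissipation_nonpos hq hA hR (not_lt.1 hc))

/-- The derivative is the linear part of `IsTight.sum_le_neg_dissipation` for `k_e = q_w / q_v`. The
logarithmic part vanishes by conservation, because active non-resetting arcs have `q_v = q_w`. -/
theorem RegularAt.hasDerivAt_conePotential {x : E → ℝ → ℝ} {ℓ : V → ℝ → ℝ} {θ : ℝ} {z : E → ℝ}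
    {q : V → ℝ} (hr : G.RegularAt x ℓ θ) (hq : G.IsConeFlow z q)
    (hA : G.active (fun v => ℓ v θ) ⊆ G.coneActive q)
    (hR : G.coneResetting q ⊆ G.resetting fun v => ℓ v θ) :
    ∃ d, HasDerivAt (fun t => G.conePotential q fun v => ℓ v t) d θ ∧
      d ≤ -G.dissipation (G.resetting fun v => ℓ v θ) (fun e => q (G.tgt e) / q (G.src e))
        (fun v => deriv (ℓ v) θ) := by
  classical
  set R := G.resetting fun v => ℓ v θ with hRdef
  have hterm : ∀ e, HasDerivAt (fun t => G.coneTerm q (fun v => ℓ v t) e)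
      (if e ∈ R then G.ν e * (deriv (ℓ (G.tgt e)) θ -
        q (G.tgt e) / q (G.src e) * deriv (ℓ (G.src e)) θ) else 0) θ := by
    intro e
    unfold coneTerm
    by_cases h1 : e ∈ G.coneResetting q
    · simp only [if_pos h1, if_pos (hR h1)]
      exact ((hr.label _).fun_sub ((hr.label _).const_mul _)).const_mul _
    have hf : e ∉ G.free := fun hf => h1 (Or.inl hf)
    by_cases h2 : e ∈ G.coneActive q
    · simp only [if_neg h1, if_pos h2]
      rw [label_eq_of_mem_coneActive h2 h1, div_self (hq.pos _).ne', one_mul]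
      convert! (hr.hasDerivAt_max_zero hf).const_mul (G.ν e) using 1
      by_cases h3 : e ∈ R
      · have h4 := h3.resolve_left hf
        rw [if_pos h3, if_pos (by linarith)]
      · have h4 : ¬ (0 < ℓ (G.tgt e) θ - ℓ (G.src e) θ - G.τ e) := fun h5 =>
          h3 (Or.inr (by linarith))
        rw [if_neg h3, if_neg h4, mul_zero]
    · have h3 : e ∉ R := fun h3 => h2 (hA (hr.tight.subset h3))
      simp only [if_neg h1, if_neg h2, if_neg h3]
      exact hasDerivAt_const _ _
  refine ⟨_, HasDerivAt.fun_sum fun e _ => hterm e, ?_⟩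
  have hlog : ∑ e with e ∈ R, deriv (x e) θ * Real.log (q (G.tgt e) / q (G.src e)) = 0 := by
    rw [← hr.tight.circulation.sum_mul_sub fun v => Real.log (q v)]
    rw [← Finset.sum_subset (Finset.subset_univ (Finset.univ.filter fun e => e ∈ R))]
    · exact Finset.sum_congr rfl fun e _ => by
        rw [Real.log_div (hq.pos _).ne' (hq.pos _).ne']
    · intro e _ he
      have he : e ∉ R := by simpa using he
      by_cases heA : e ∈ G.active fun v => ℓ v θ
      · rw [label_eq_of_mem_coneActive (hA heA) fun hc => he (hR hc), sub_self, mul_zero]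
      · rw [hr.tight.flow_eq_zero e heA, zero_mul]
  have h1 := hr.tight.sum_le_neg_dissipation (k := fun e => q (G.tgt e) / q (G.src e))
    fun e _ => div_pos (hq.pos _) (hq.pos _)
  rw [Finset.sum_add_distrib] at h1
  rw [← Finset.sum_filter]
  linarith

namespace IsNashFlow

variable {x : E → ℝ → ℝ} {ℓ : V → ℝ → ℝ}

/-- Eventually, the active and resetting arcs are compatible with the asymptotic directions. -/
theorem exists_compatible (h : G.IsNashFlow x ℓ) {z : E → ℝ} {q : V → ℝ}
    (hq : G.IsConeFlow z q) :
    ∃ Θ : ℝ, 0 ≤ Θ ∧ ∀ θ, Θ ≤ θ → G.active (fun v => ℓ v θ) ⊆ G.coneActive q ∧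
      G.coneResetting q ⊆ G.resetting fun v => ℓ v θ := by
  have hdiff : ∀ e, Tendsto (fun θ => (ℓ (G.tgt e) θ - ℓ (G.src e) θ - G.τ e) / θ) atTop
      (𝓝 (q (G.tgt e) - q (G.src e))) := by
    intro e
    have h2 := ((h.tendsto_label_div hq (G.tgt e)).sub (h.tendsto_label_div hq (G.src e))).sub
      (tendsto_const_nhds.div_atTop tendsto_id : Tendsto (fun θ : ℝ => G.τ e / θ) atTop (𝓝 0))
    rw [sub_zero] at h2
    refine h2.congr fun n => ?_
    rw [sub_div, sub_div]
  have hev : ∀ᶠ θ in atTop, ∀ e,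
      (e ∈ G.active (fun v => ℓ v θ) → e ∈ G.coneActive q) ∧
      (e ∈ G.coneResetting q → e ∈ G.resetting fun v => ℓ v θ) := by
    refine eventually_all.2 fun e => ?_
    by_cases hf : e ∈ G.free
    · exact Eventually.of_forall fun θ => ⟨fun _ => Or.inl hf, fun _ => Or.inl hf⟩
    rcases lt_trichotomy (q (G.src e)) (q (G.tgt e)) with hlt | heq | hgt
    · filter_upwards [(hdiff e).eventually_const_lt (sub_pos.2 hlt), eventually_gt_atTop 0]
        with θ hθ h0
      rw [div_pos_iff_of_pos_right h0] at hθ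
      exact ⟨fun _ => Or.inr hlt.le, fun _ => Or.inr (by linarith)⟩
    · exact Eventually.of_forall fun θ => ⟨fun _ => Or.inr heq.le, fun hc =>
        absurd heq (hc.resolve_left hf).ne⟩
    · filter_upwards [(hdiff e).eventually_lt_const (sub_neg.2 hgt), eventually_gt_atTop 0]
        with θ hθ h0
      rw [div_lt_iff₀ h0, zero_mul] at hθ
      refine ⟨fun hA => absurd (hA.resolve_left hf) (by linarith), fun hc => ?_⟩
      exact absurd (hc.resolve_left hf) hgt.not_gt
  obtain ⟨Θ, hΘ⟩ := eventually_atTop.1 hev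
  exact ⟨max 0 Θ, le_max_left _ _, fun θ hθ =>
    ⟨fun e => (hΘ θ ((le_max_right _ _).trans hθ) e).1,
      fun e => (hΘ θ ((le_max_right _ _).trans hθ) e).2⟩⟩

/-- The labels of a Nash flow over time eventually grow linearly. -/
theorem exists_label_linear (h : G.IsNashFlow x ℓ) {z : E → ℝ} {q : V → ℝ}
    (hq : G.IsConeFlow z q) :
    ∃ θ₀ : ℝ, 0 ≤ θ₀ ∧ (∀ θ, θ₀ ≤ θ → ∀ v, ℓ v θ = ℓ v θ₀ + q v * (θ - θ₀)) ∧
      ∀ θ, θ₀ ≤ θ → G.active (fun v => ℓ v θ) ⊆ G.coneActive q ∧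
        G.coneResetting q ⊆ G.resetting fun v => ℓ v θ := by
  obtain ⟨Θ, hΘ0, hΘ⟩ := h.exists_compatible hq
  obtain ⟨c, hc, hgap⟩ := hq.exists_dissipation_gap
  have hderiv : ∀ θ, Θ ≤ θ → G.RegularAt x ℓ θ → (fun v => deriv (ℓ v) θ) ≠ q →
      deriv (fun t => G.conePotential q fun v => ℓ v t) θ ≤ -c := by
    intro θ hθ hr hne
    obtain ⟨d, hd, hd'⟩ := hr.hasDerivAt_conePotential hq (hΘ θ hθ).1 (hΘ θ hθ).2
    rw [hd.deriv]
    exact hd'.trans (neg_le_neg (hgap _ _ _ _ hr.tight (hΘ θ hθ).1 (hΘ θ hθ).2 hne))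
  have hex : ∃ θ₀, Θ ≤ θ₀ ∧ G.RegularAt x ℓ θ₀ ∧ (fun v => deriv (ℓ v) θ₀) = q := by
    by_contra! hcon
    set W := G.conePotential q fun v => ℓ v Θ with hW
    -- After this time a decrease at rate `c` would take the potential `c` below its lower bound.
    set r := (W + G.coneCost q z) / c + 1 with hr
    have h1 : -G.coneCost q z ≤ W := hq.neg_coneCost_le _
    have hr0 : 0 ≤ (W + G.coneCost q z) / c := div_nonneg (by linarith) hc.le
    have hΘr : Θ ≤ Θ + r := by linarith
    have h2 := (h.conePotential_ac q hΘ0 hΘr).sub_le_mul hΘr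
      (h.ae_regular_Icc hΘ0 fun θ hθ hreg => hderiv θ hθ.1 hreg (hcon θ hθ.1 hreg))
    have h3 := hq.neg_coneCost_le fun v => ℓ v (Θ + r)
    have h4 : -c * (Θ + r - Θ) = -(W + G.coneCost q z) - c := by
      rw [hr]
      field_simp
      ring
    linarith
  obtain ⟨θ₀, hθ₀, hreg, hlam⟩ := hex
  have hθ₀0 : 0 ≤ θ₀ := hΘ0.trans hθ₀
  have hlam' : ∀ v, deriv (ℓ v) θ₀ = q v := fun v => congrFun hlam v
  -- The flow rates at `θ₀` themselves form a cone flow and satisfy complementary slackness with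
  -- `ℓ(θ₀)`, so the potential is minimal there.
  have hcone : G.IsConeFlow (fun e => deriv (x e) θ₀) q := by
    refine ⟨hq.free_subset, hq.subset, hq.reaches, hreg.tight.circulation, hreg.tight.flow_nonneg,
      hq.label_nonneg, hq.label_source,
      fun e he => hreg.tight.flow_eq_zero e fun hc => he ((hΘ θ₀ hθ₀).1 hc),
      fun e he => ?_, fun e => ?_, hq.label_eq⟩
    · rw [hreg.tight.flow_eq e ((hΘ θ₀ hθ₀).2 he), hlam']
    · rw [← hlam']
      exact hreg.tight.flow_le e
  have hmin : ∀ θ, (G.conePotential q fun v => ℓ v θ₀) ≤ G.conePotential q fun v => ℓ v θ := by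
    intro θ
    rw [hcone.conePotential_eq (l := fun v => ℓ v θ₀)
      (fun e he => by rw [hreg.tight.flow_eq e he, hlam']) hreg.tight.flow_eq_zero]
    exact hcone.neg_coneCost_le _
  have hconst : ∀ θ, θ₀ ≤ θ →
      (G.conePotential q fun v => ℓ v θ) = G.conePotential q fun v => ℓ v θ₀ := by
    intro θ hθ
    refine le_antisymm ?_ (hmin θ)
    have h1 := (h.conePotential_ac q hθ₀0 hθ).sub_le_mul (c := 0) hθ
      (h.ae_regular_Icc hθ₀0 fun t ht hr => by
        obtain ⟨d, hd, hd'⟩ := hr.hasDerivAt_conePotential hq (hΘ t (hθ₀.trans ht.1)).1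
          (hΘ t (hθ₀.trans ht.1)).2
        rw [hd.deriv]
        exact hd'.trans (neg_nonpos.2 (dissipation_nonneg _ _ _)))
    linarith
  have hrate : ∀ θ, θ₀ ≤ θ → G.RegularAt x ℓ θ → ∀ v, deriv (ℓ v) θ = q v := by
    intro θ hθ hr v
    rcases hθ.eq_or_lt with rfl | hlt
    -- After `θ₀` the potential is constant on a two-sided neighbourhood, so its derivative is zero,
    -- which excludes a decrease at rate `c`.
    · exact hlam' v
    · by_contra hne
      have h1 := hderiv θ (hθ₀.trans hθ) hr fun hc => hne (congrFun hc v)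
      have h2 : (fun t => G.conePotential q fun v => ℓ v t) =ᶠ[𝓝 θ]
          fun _ => G.conePotential q fun v => ℓ v θ₀ := by
        filter_upwards [Ioi_mem_nhds hlt] with t ht
        exact hconst t (le_of_lt ht)
      rw [h2.deriv_eq, deriv_const] at h1
      linarith
  refine ⟨θ₀, hθ₀0, fun θ hθ v => ?_, fun θ hθ => hΘ θ (hθ₀.trans hθ)⟩
  have h1 := (h.label_ac_on v hθ₀0 hθ).mul_le_sub hθ
    (h.ae_regular_Icc hθ₀0 fun t ht hr => (hrate t ht.1 hr v).ge)
  have h2 := (h.label_ac_on v hθ₀0 hθ).sub_le_mul hθ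
    (h.ae_regular_Icc hθ₀0 fun t ht hr => (hrate t ht.1 hr v).le)
  linarith

/-- On a non-free arc, `q_v < q_w` keeps the arc resetting, `q_v = q_w` keeps the label difference
constant, and `q_v > q_w` keeps it inactive. The positive part therefore never switches. -/
theorem exists_queue_linear (h : G.IsNashFlow x ℓ) {z : E → ℝ} {q : V → ℝ}
    (hq : G.IsConeFlow z q) :
    ∃ θ₀ : ℝ, 0 ≤ θ₀ ∧ ∀ e θ, θ₀ ≤ θ →
      G.queue ℓ e θ = G.queue ℓ e θ₀ + G.steadyRate q e * (θ - θ₀) := by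
  obtain ⟨θ₀, h0, hlin, hcomp⟩ := h.exists_label_linear hq
  refine ⟨θ₀, h0, fun e θ hθ => ?_⟩
  unfold queue steadyRate
  split_ifs with hf
  · rw [hlin θ hθ (G.tgt e), hlin θ hθ (G.src e)]
    ring
  rcases lt_trichotomy (q (G.src e)) (q (G.tgt e)) with hlt | heq | hgt
  · have hpos : ∀ t, θ₀ ≤ t → 0 < ℓ (G.tgt e) t - ℓ (G.src e) t - G.τ e := fun t ht => by
      have := ((hcomp t ht).2 (Or.inr hlt : e ∈ G.coneResetting q)).resolve_left hf
      linarith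
    rw [max_eq_right (hpos θ hθ).le, max_eq_right (hpos θ₀ le_rfl).le,
      max_eq_right (sub_pos.2 hlt).le, hlin θ hθ (G.tgt e), hlin θ hθ (G.src e)]
    ring
  · rw [hlin θ hθ (G.tgt e), hlin θ hθ (G.src e), heq, sub_self, max_self, zero_mul, add_zero,
      add_sub_add_right_eq_sub]
  · have hneg : ∀ t, θ₀ ≤ t → ℓ (G.tgt e) t - ℓ (G.src e) t - G.τ e ≤ 0 := fun t ht => by
      by_contra hc
      rcases (hcomp t ht).1 (Or.inr (by linarith) : e ∈ G.active fun v => ℓ v t) with h1 | h1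
      · exact hf h1
      · linarith
    rw [max_eq_left (hneg θ hθ), max_eq_left (hneg θ₀ le_rfl), max_eq_left (sub_neg.2 hgt).le]
    ring

end IsNashFlow

end GeneralizedNetwork

theorem mainTheorem3 {V E : Type*} [Fintype V] [Fintype E] (G : GeneralizedNetwork V E) :
    ∃ (y : E → ℝ) (lam : V → ℝ), G.IsThinFlow Set.univ G.free y lam ∧
      ∀ (x : E → ℝ → ℝ) (ℓ : V → ℝ → ℝ), G.IsNashFlow x ℓ →
        ∃ θ₀ : ℝ, 0 ≤ θ₀ ∧ G.InSteadyState ℓ θ₀ ∧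
          ∀ e, ∀ θ ≥ θ₀,
            HasDerivWithinAt (G.queue ℓ e) (G.steadyRate lam e) (Set.Ici θ₀) θ := by
  obtain ⟨y, q, hq⟩ := G.exists_coneFlow
  refine ⟨y, q, hq.isThinFlow, fun x ℓ h => ?_⟩
  obtain ⟨θ₀, h0, hlin⟩ := h.exists_queue_linear hq
  have hd : ∀ e, ∀ θ ≥ θ₀,
      HasDerivWithinAt (G.queue ℓ e) (G.steadyRate q e) (Set.Ici θ₀) θ := by
    intro e θ hθ
    have h1 : HasDerivAt (fun t => G.queue ℓ e θ₀ + G.steadyRate q e * (t - θ₀))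
        (G.steadyRate q e) θ := by
      simpa using (((hasDerivAt_id θ).sub_const θ₀).const_mul (G.steadyRate q e)).const_add
        (G.queue ℓ e θ₀)
    exact h1.hasDerivWithinAt.congr (fun t ht => hlin e t ht) (hlin e θ hθ)
  exact ⟨θ₀, h0, ⟨G.steadyRate q, hd⟩, hd⟩
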